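/- Let $n\ge 0$, $E,A\in\mathbb{R}^{n\times n}$ ($E$ possibly singular) and $1<\alpha<2$. Consider the autonomous singular fractional order system $$E\,D^{\alpha}x(t)=A\,x(t),\qquad t>0,\quad x(t)\in\mathbb{R}^n, \tag{$*$}$$ where $D^\alpha$ is the Caputo derivative $$D^{\alpha}f(t)=\frac1{\Gamma(2-\alpha)}\int_0^t (t-\tau)^{1-\alpha}f''(\tau)\,d\tau .$$ A solution is a function $x:[0,\infty)\to\mathbb{R}^n$ that is continuous on $[0,\infty)$, twice continuously differentiable on $(0,\infty)$ with $x''$ integrable on $(0,T)$ for every $T>0$, and satisfies $(*)$ for all $t>0$. The system is regular if a solution is uniquely determined by its initial values $x(0),x'(0)$. A vector $x_0$ is an admissible initial condition if some solution has $x(0)=x_0$. The system is asymptotically stable if, for every admissible initial condition $x_0$, every solution with $x(0)=x_0$ satisfies $\lim_{t\to+\infty}\|x(t)\|=0$. **Theorem.** Suppose that the system $(*)$ is regular. Then it is asymptotically stable if and only if every finite generalized eigenvalue of the pencil $(E,A)$, that is, every $\lambda\in\mathbb{C}$ with $\det(\lambda E-A)=0$, satisfies $$|\arg\lambda|>\frac{\alpha\pi}{2},$$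 where $\arg\lambda\in(-\pi,\pi]$ is the principal argument and $\arg 0:=0$ (so that $\lambda=0$ violates the condition). -/

import Mathlib

open Filter Topology Set

noncomputable section

namespace SFOS

/-- The Caputo fractional derivative of order `α` with `1 < α < 2` and base point `0`,
`(D^α f)(t) = 1 / Γ(2 - α) * ∫_0^t (t - τ)^(1 - α) f''(τ) dτ`. -/
def caputoDeriv {V : Type*} [NormedAddCommGroup V] [NormedSpace ℝ V]
    (α : ℝ) (f : ℝ → V) (t : ℝ) : V :=
  (Real.Gamma (2 - α))⁻¹ • ∫ τ in (0 : ℝ)..t, (t - τ) ^ (1 - α) • deriv (deriv f) τ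

variable {n : ℕ}

/-- `x` is a solution on `[0, ∞)` of the singular fractional order system `E D^α x = A x`
(`1 < α < 2`): it is continuous on `[0, ∞)`, twice continuously differentiable on `(0, ∞)` with
`x''` integrable on every `(0, T)`, and the equation holds at every `t > 0`. Integrability of
`x''` makes the integral in `D^α x` converge; it also gives `x` a right derivative at `0`.
(One cannot ask for `x''` to be continuous at `0`: the Mittag-Leffler solutions of
`D^α x = A x` have `x''(t)` of size `t^(α - 2)` there.) The values of `x` at negative times
play no role. -/
structure IsSolution (E A : Matrix (Fin n) (Fin n) ℝ) (α : ℝ) (x : ℝ → Fin n → ℝ) : Prop where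
  continuousOn : ContinuousOn x (Ici 0)
  contDiffOn : ContDiffOn ℝ 2 x (Ioi 0)
  integrable : ∀ T : ℝ, 0 < T → IntervalIntegrable (deriv (deriv x)) MeasureTheory.volume 0 T
  equation : ∀ t : ℝ, 0 < t → E.mulVec (caputoDeriv α x t) = A.mulVec (x t)

/-- The system `E D^α x = A x` is regular: the initial values `x(0)` and `x'(0)` determine the
solution uniquely. -/
def IsRegular (E A : Matrix (Fin n) (Fin n) ℝ) (α : ℝ) : Prop :=
  ∀ x y : ℝ → Fin n → ℝ, IsSolution E A α x → IsSolution E A α y →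
    x 0 = y 0 → derivWithin x (Ici 0) 0 = derivWithin y (Ici 0) 0 →
    ∀ t : ℝ, 0 ≤ t → x t = y t

/-- `x₀` is an admissible initial condition: some solution (in particular, one without
discontinuous behaviour at `t = 0`) starts at `x₀`. -/
def IsAdmissibleInitial (E A : Matrix (Fin n) (Fin n) ℝ) (α : ℝ) (x₀ : Fin n → ℝ) : Prop :=
  ∃ x : ℝ → Fin n → ℝ, IsSolution E A α x ∧ x 0 = x₀

/-- Asymptotic stability: for every admissible initial condition `x₀`, the solutions starting
at `x₀` satisfy `‖x(t)‖ → 0` as `t → ∞`. -/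
def IsAsymptoticallyStable (E A : Matrix (Fin n) (Fin n) ℝ) (α : ℝ) : Prop :=
  ∀ x₀ : Fin n → ℝ, IsAdmissibleInitial E A α x₀ →
    ∀ x : ℝ → Fin n → ℝ, IsSolution E A α x → x 0 = x₀ →
      Tendsto (fun t : ℝ => ‖x t‖) atTop (𝓝 0)

/-- The set of finite generalized eigenvalues of the pencil `(E, A)`: the complex `s` with
`det (s E - A) = 0`. -/
def finiteSpectrum (E A : Matrix (Fin n) (Fin n) ℝ) : Set ℂ :=
  {s : ℂ | (s • E.map (fun r : ℝ => (r : ℂ)) - A.map (fun r : ℝ => (r : ℂ))).det = 0}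

end SFOS

end

/-! Sufficiency. Since `arg 0 = 0`, the sector condition excludes the eigenvalue `0`, so `A` is
invertible and a solution satisfies `z = M D^α z` with `M = A⁻¹ E`. The Fitting decomposition splits
off the nilpotent part of `M`, on which `z` must vanish. What remains is `D^α z = N z`, where every
eigenvalue of `N` is a finite eigenvalue of the pencil or the harmless value `-1`, whose argument is
`π` (`exists_reduced_equation`).

Integrating, `z = z₀ + t z₁ + I^α (N z)`, so `z` grows at most exponentially and, far enough to the
right, its Laplace transform is `(p^α - N)⁻¹ (p^(α-1) z₀ + p^(α-2) z₁)`. The map `p ↦ p^α` sends the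
closed right half-plane into `|arg| ≤ α π / 2`, which avoids the spectrum of `N`; the formula
therefore continues holomorphically to that half-plane without `0`. After subtracting the transform
of `e^{-t} z₀` it is `O(|p|^(α-2))` at `0`, integrable on the imaginary axis because `α > 1`, and
`O(|p|^(-2))` at infinity. The inversion contour can be moved to the imaginary axis, and the
Riemann-Lebesgue lemma gives decay (`tendsto_zero_of_volterra`).

Necessity. An eigenvector `v` for an eigenvalue `s` produces the real solutions `Re (E_α(s t^α) c
v)`. If `|arg s| ≤ α π / 2` and `s ≠ 0`, then `q = s^(1/α)` has `Re q ≥ 0`, and the Laplace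
transform `p^(α-1) / (p^α - s)` has a simple pole at `q`. An Abelian argument forbids such a pole
for a function tending to `0` (`not_tendsto_mlFun`). -/

noncomputable section

namespace SFOS

open MeasureTheory

/-! ### Riemann-Liouville integrals and the Volterra form of the Caputo equation -/

section

/-- The Riemann-Liouville kernel `t ^ (b - 1) / Γ(b)`. -/
def rlKernel (b t : ℝ) : ℝ := t ^ (b - 1) / Real.Gamma b

/-- The Riemann-Liouville integral of order `b` with base point `0`. -/
def rlIntegral {V : Type*} [NormedAddCommGroup V] [NormedSpace ℝ V]
    (b : ℝ) (f : ℝ → V) (t : ℝ) : V :=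
  ∫ τ in (0 : ℝ)..t, rlKernel b (t - τ) • f τ

lemma measurable_rlKernel (b : ℝ) : Measurable (rlKernel b) := by
  unfold rlKernel; fun_prop

lemma rlKernel_nonneg {b t : ℝ} (hb : 0 < b) (ht : 0 ≤ t) : 0 ≤ rlKernel b t :=
  div_nonneg (Real.rpow_nonneg ht _) (Real.Gamma_pos_of_pos hb).le

lemma rlKernel_mono {b s t : ℝ} (hb : 1 ≤ b) (hs : 0 ≤ s) (hst : s ≤ t) :
    rlKernel b s ≤ rlKernel b t :=
  div_le_div_of_nonneg_right (Real.rpow_le_rpow hs hst (by linarith))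
    (Real.Gamma_pos_of_pos (by linarith)).le

lemma rlKernel_one (t : ℝ) : rlKernel 1 t = 1 := by simp [rlKernel]

lemma rlKernel_two (t : ℝ) : rlKernel 2 t = t := by
  norm_num [rlKernel, Real.Gamma_two]

lemma intervalIntegrable_rlKernel {b : ℝ} (hb : 0 < b) (s t : ℝ) :
    IntervalIntegrable (rlKernel b) volume s t :=
  (intervalIntegral.intervalIntegrable_rpow' (by linarith)).div_const _

/-- Euler's identity `B(a, b) = Γ(a) Γ(b) / Γ(a + b)`, read off from the complex Beta integral. The
factor `1 / Γ(b)` in the kernel is what makes the kernels a convolution semigroup. -/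
lemma integral_rlKernel_mul_rlKernel {a b t : ℝ} (ha : 0 < a) (hb : 0 < b) (ht : 0 < t) :
    ∫ τ in (0 : ℝ)..t, rlKernel a (t - τ) * rlKernel b τ = rlKernel (a + b) t := by
  have h := Complex.betaIntegral_scaled b a ht
  have e : ∫ x in (0 : ℝ)..t, (x : ℂ) ^ ((b : ℂ) - 1) * ((t : ℂ) - x) ^ ((a : ℂ) - 1)
      = ((∫ x in (0 : ℝ)..t, x ^ (b - 1) * (t - x) ^ (a - 1) : ℝ) : ℂ) := by
    rw [← intervalIntegral.integral_ofReal]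
    refine intervalIntegral.integral_congr fun x hx => ?_
    rw [uIcc_of_le ht.le] at hx
    push_cast
    rw [Complex.ofReal_cpow hx.1, Complex.ofReal_cpow (sub_nonneg.2 hx.2)]
    push_cast; rfl
  have h2 : ∫ x in (0 : ℝ)..t, x ^ (b - 1) * (t - x) ^ (a - 1)
      = t ^ (a + b - 1) * (Real.Gamma b * Real.Gamma a / Real.Gamma (a + b)) := by
    rw [e] at h
    have hB : Complex.betaIntegral b a
        = ((Real.Gamma b * Real.Gamma a / Real.Gamma (a + b) : ℝ) : ℂ) := by
      rw [Complex.betaIntegral_eq_Gamma_mul_div b a (by simpa) (by simpa), add_comm a b]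
      push_cast [Complex.Gamma_ofReal, ← Complex.ofReal_add]
      rfl
    rw [hB, show (b : ℂ) + a - 1 = ((a + b - 1 : ℝ) : ℂ) by push_cast; ring,
      ← Complex.ofReal_cpow ht.le] at h
    exact_mod_cast h
  have hGa := (Real.Gamma_pos_of_pos ha).ne'
  have hGb := (Real.Gamma_pos_of_pos hb).ne'
  calc _ = ∫ x in (0 : ℝ)..t, (Real.Gamma a * Real.Gamma b)⁻¹ * (x ^ (b - 1) * (t - x) ^ (a - 1)) := by
        refine intervalIntegral.integral_congr fun x _ => ?_
        simp only [rlKernel]; field_simp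
    _ = _ := by
        rw [intervalIntegral.integral_const_mul, h2, rlKernel]; field_simp

lemma integral_rlKernel_sub_mul_rlKernel_sub {a b τ t : ℝ} (ha : 0 < a) (hb : 0 < b) (h : τ < t) :
    ∫ s in τ..t, rlKernel a (t - s) * rlKernel b (s - τ) = rlKernel (a + b) (t - τ) := by
  rw [← integral_rlKernel_mul_rlKernel ha hb (sub_pos.2 h)]
  have := intervalIntegral.integral_comp_sub_right (a := τ) (b := t)
    (fun u => rlKernel a (t - τ - u) * rlKernel b u) τ
  rw [sub_self] at this
  rw [← this]
  refine intervalIntegral.integral_congr fun x _ => ?_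
  congr 2; ring

variable {V : Type*} [NormedAddCommGroup V] [NormedSpace ℝ V]

/-- The semigroup property of Riemann-Liouville integrals. -/
lemma rlIntegral_rlIntegral [CompleteSpace V] {a b t : ℝ} (ha : 1 ≤ a) (hb : 0 < b) (ht : 0 < t)
    {w : ℝ → V} (hw : IntervalIntegrable w volume 0 t) :
    rlIntegral a (rlIntegral b w) t = rlIntegral (a + b) w t := by
  have ha0 : 0 < a := by linarith
  -- Cutting off at `(0, t)` turns the integral over the triangle `0 < τ < s < t` into one over the
  -- plane. The integrand becomes a convolution integrand times `h`, and `h` is bounded because `a ≥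
  -- 1`, so Fubini applies.
  set f : ℝ → V := (Ioo 0 t).indicator w with hf
  set g : ℝ → ℝ := (Ioo 0 t).indicator (rlKernel b) with hg
  set h : ℝ → ℝ := (Ioo 0 t).indicator (fun s => rlKernel a (t - s)) with hh
  have hfi : Integrable f := by
    rw [hf, integrable_indicator_iff measurableSet_Ioo]
    exact ((intervalIntegrable_iff_integrableOn_Ioc_of_le ht.le).1 hw).mono_set Ioo_subset_Ioc_self
  have hgi : Integrable g := by
    rw [hg, integrable_indicator_iff measurableSet_Ioo]
    exact ((intervalIntegrable_iff_integrableOn_Ioc_of_le ht.le).1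
      (intervalIntegrable_rlKernel hb 0 t)).mono_set Ioo_subset_Ioc_self
  have hhm : Measurable h :=
    ((measurable_rlKernel a).comp (measurable_const.sub measurable_id)).indicator measurableSet_Ioo
  have hhb : ∀ s, ‖h s‖ ≤ rlKernel a t := by
    intro s
    by_cases hs : s ∈ Ioo 0 t
    · rw [hh, indicator_of_mem hs, Real.norm_of_nonneg (rlKernel_nonneg ha0 (by linarith [hs.2]))]
      exact rlKernel_mono ha (by linarith [hs.2]) (by linarith [hs.1])
    · rw [hh, indicator_of_notMem hs, norm_zero]
      exact rlKernel_nonneg ha0 ht.le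
  have hF : Integrable (fun p : ℝ × ℝ => h p.1 • (g (p.1 - p.2) • f p.2)) (volume.prod volume) := by
    have h1 : Integrable (fun p : ℝ × ℝ => g (p.1 - p.2) • f p.2) (volume.prod volume) :=
      hfi.convolution_integrand (ContinuousLinearMap.lsmul ℝ ℝ).flip hgi
    exact h1.bdd_smul (rlKernel a t) (hhm.comp measurable_fst).aestronglyMeasurable
      (Eventually.of_forall fun p => hhb p.1)
  have hswap := integral_integral_swap (f := fun s τ => h s • (g (s - τ) • f τ)) hF
  have e1 : rlIntegral a (rlIntegral b w) t = ∫ s, ∫ τ, h s • (g (s - τ) • f τ) := by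
    rw [rlIntegral, intervalIntegral.integral_of_le ht.le, integral_Ioc_eq_integral_Ioo,
      ← integral_indicator measurableSet_Ioo]
    refine integral_congr_ae (Eventually.of_forall fun s => ?_)
    simp only
    rw [integral_smul]
    by_cases hs : s ∈ Ioo 0 t
    · rw [indicator_of_mem hs, hh, indicator_of_mem hs]
      congr 1
      rw [rlIntegral, intervalIntegral.integral_of_le hs.1.le, integral_Ioc_eq_integral_Ioo,
        ← integral_indicator measurableSet_Ioo]
      refine integral_congr_ae (Eventually.of_forall fun τ => ?_)
      simp only
      by_cases hτ : τ ∈ Ioo 0 s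
      · rw [indicator_of_mem hτ, hg, hf, indicator_of_mem, indicator_of_mem]
        · exact ⟨hτ.1, hτ.2.trans hs.2⟩
        · exact ⟨sub_pos.2 hτ.2, by linarith [hτ.1, hs.2]⟩
      · rw [indicator_of_notMem hτ]
        by_cases h0 : 0 < τ
        · rw [hg, indicator_of_notMem, zero_smul]
          intro h1; exact hτ ⟨h0, by linarith [h1.1]⟩
        · rw [hf, indicator_of_notMem, smul_zero]
          intro h1; exact h0 h1.1
    · rw [indicator_of_notMem hs, hh, indicator_of_notMem hs, zero_smul]
  have e2 : rlIntegral (a + b) w t = ∫ τ, ∫ s, h s • (g (s - τ) • f τ) := by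
    rw [rlIntegral, intervalIntegral.integral_of_le ht.le, integral_Ioc_eq_integral_Ioo,
      ← integral_indicator measurableSet_Ioo]
    refine integral_congr_ae (Eventually.of_forall fun τ => ?_)
    simp only [smul_smul]
    by_cases hτ : τ ∈ Ioo 0 t
    · rw [indicator_of_mem hτ, integral_smul_const, hf, indicator_of_mem hτ]
      congr 1
      rw [← integral_rlKernel_sub_mul_rlKernel_sub ha0 hb hτ.2,
        intervalIntegral.integral_of_le hτ.2.le, integral_Ioc_eq_integral_Ioo,
        ← integral_indicator measurableSet_Ioo]
      refine integral_congr_ae (Eventually.of_forall fun s => ?_)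
      simp only
      by_cases hs : s ∈ Ioo τ t
      · rw [indicator_of_mem hs, hg, hh, indicator_of_mem, indicator_of_mem]
        · exact ⟨sub_pos.2 hs.1, by linarith [hs.2, hτ.1]⟩
        · exact ⟨hτ.1.trans hs.1, hs.2⟩
      · rw [indicator_of_notMem hs]
        by_cases h0 : s < t
        · rw [hg, indicator_of_notMem, mul_zero]
          intro h1; exact hs ⟨by linarith [h1.1], h0⟩
        · rw [hh, indicator_of_notMem, zero_mul]
          intro h1; exact h0 h1.2
    · rw [indicator_of_notMem hτ, hf, indicator_of_notMem hτ]
      simp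
  rw [e1, e2, hswap]

/-- The semigroup law then gives `I^α D^α = I^α I^(2-α) d²/dt² = I² d²/dt²`. -/
lemma caputoDeriv_eq_rlIntegral (α : ℝ) (f : ℝ → V) (t : ℝ) :
    caputoDeriv α f t = rlIntegral (2 - α) (deriv (deriv f)) t := by
  rw [caputoDeriv, rlIntegral, ← intervalIntegral.integral_smul]
  refine intervalIntegral.integral_congr fun τ _ => ?_
  simp only [rlKernel]
  rw [smul_smul]
  congr 1
  rw [show (2 - α - 1 : ℝ) = 1 - α by ring]; ring

/-- The regularity required of a solution. -/
structure IsAdmissible (z : ℝ → V) : Prop where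
  continuousOn : ContinuousOn z (Ici 0)
  contDiffOn : ContDiffOn ℝ 2 z (Ioi 0)
  integrable : ∀ T : ℝ, 0 < T → IntervalIntegrable (deriv (deriv z)) volume 0 T

lemma IsAdmissible.hasDerivAt {z : ℝ → V} (hz : IsAdmissible z) {t : ℝ} (ht : 0 < t) :
    HasDerivAt z (deriv z t) t :=
  ((hz.contDiffOn.contDiffAt (Ioi_mem_nhds ht)).differentiableAt (by norm_num)).hasDerivAt

lemma IsAdmissible.contDiffOn_deriv {z : ℝ → V} (hz : IsAdmissible z) :
    ContDiffOn ℝ 1 (deriv z) (Ioi 0) :=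
  ((contDiffOn_succ_iff_deriv_of_isOpen (n := 1) isOpen_Ioi).1
    (by simpa [one_add_one_eq_two] using hz.contDiffOn)).2.2

lemma IsAdmissible.hasDerivAt_deriv {z : ℝ → V} (hz : IsAdmissible z) {t : ℝ} (ht : 0 < t) :
    HasDerivAt (deriv z) (deriv (deriv z) t) t :=
  ((hz.contDiffOn_deriv.contDiffAt (Ioi_mem_nhds ht)).differentiableAt (by norm_num)).hasDerivAt

variable [CompleteSpace V]

/-- Taylor's formula with integral remainder at the base point `0`. -/
lemma IsAdmissible.exists_eq_add {z : ℝ → V} (hz : IsAdmissible z) :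
    ∃ z₁ : V, ∀ t, 0 < t → z t = z 0 + t • z₁ + rlIntegral 2 (deriv (deriv z)) t := by
  set w := deriv (deriv z) with hw
  -- `u` extends `z'` continuously to `0`. It is based at `1` because `z'` is only controlled on
  -- `(0, ∞)`; its value at `0` is the initial velocity `z₁`.
  set u : ℝ → V := fun τ => deriv z 1 + ∫ s in (1 : ℝ)..τ, w s with hu
  have hwi : ∀ a b, 0 ≤ a → 0 ≤ b → IntervalIntegrable w volume a b := by
    intro a b ha hb
    have h1 := hz.integrable (max a b + 1) (by positivity)
    refine h1.mono_set ?_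
    rw [uIcc_of_le (by positivity : (0 : ℝ) ≤ max a b + 1)]
    intro x hx
    rcases hx with ⟨h2, h3⟩
    exact ⟨(le_min ha hb).trans h2, h3.trans (by linarith)⟩
  have hu1 : ∀ τ, 0 < τ → u τ = deriv z τ := by
    intro τ hτ
    have : ∫ s in (1 : ℝ)..τ, w s = deriv z τ - deriv z 1 := by
      refine intervalIntegral.integral_eq_sub_of_hasDerivAt (fun x hx => ?_) (hwi _ _ zero_le_one hτ.le)
      exact hz.hasDerivAt_deriv (lt_of_lt_of_le (lt_min one_pos hτ) hx.1)
    rw [hu]; simp only; rw [this]; abel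
  refine ⟨u 0, fun t ht => ?_⟩
  have huc : ContinuousOn u (Icc 0 t) := by
    refine continuousOn_const.add ?_
    have := intervalIntegral.continuousOn_primitive_interval' (hwi 0 (max t 1) le_rfl (by positivity))
      (a := 1) (by rw [uIcc_of_le (by positivity)]; exact ⟨zero_le_one, le_max_right _ _⟩)
    refine this.mono ?_
    rw [uIcc_of_le (by positivity)]
    exact Icc_subset_Icc_right (le_max_left _ _)
  -- The function `z τ + (t - τ) u τ` equals `z t` at `τ = t` and `z 0 + t z₁` at `τ = 0`; in its
  -- derivative the terms `z'` and `-u` cancel.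
  have key := intervalIntegral.integral_eq_sub_of_hasDerivAt_of_le ht.le
    (f := fun τ => z τ + (t - τ) • u τ) (f' := fun τ => (t - τ) • w τ)
    ((hz.continuousOn.mono Icc_subset_Ici_self).add
      (ContinuousOn.smul (by fun_prop) huc)) (fun τ hτ => by
        have h1 := hz.hasDerivAt hτ.1
        have h2 : HasDerivAt u (w τ) τ := (hz.hasDerivAt_deriv hτ.1).congr_of_eventuallyEq (by
          filter_upwards [Ioi_mem_nhds hτ.1] with x hx using hu1 x hx)
        have h3 := h1.add (((hasDerivAt_const τ t).sub (hasDerivAt_id τ)).smul h2)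
        refine h3.congr_deriv ?_
        simp [hu1 τ hτ.1])
    ((hwi 0 t le_rfl ht.le).continuousOn_smul (by fun_prop))
  rw [rlIntegral]
  simp only [rlKernel_two]
  rw [key]
  simp

/-- The Volterra integral equation satisfied by the solutions of `D^α z = N z`. -/
lemma IsAdmissible.exists_volterra {z : ℝ → V} (hz : IsAdmissible z) {α : ℝ} (hα₁ : 1 < α)
    (hα₂ : α < 2) (N : V → V) (hN : ∀ t, 0 < t → caputoDeriv α z t = N (z t)) :
    ∃ z₁ : V, ∀ t, 0 < t → z t = z 0 + t • z₁ + rlIntegral α (fun s => N (z s)) t := by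
  obtain ⟨z₁, h⟩ := hz.exists_eq_add
  refine ⟨z₁, fun t ht => ?_⟩
  rw [h t ht]
  congr 1
  have := rlIntegral_rlIntegral hα₁.le (sub_pos.2 hα₂) ht (hz.integrable t ht)
  rw [add_sub_cancel] at this
  rw [← this, rlIntegral, rlIntegral, intervalIntegral.integral_of_le ht.le,
    intervalIntegral.integral_of_le ht.le]
  refine setIntegral_congr_fun measurableSet_Ioc fun s hs => ?_
  rw [← hN s hs.1, caputoDeriv_eq_rlIntegral]

end

/-! ### Laplace transforms and exponential bounds -/

section

lemma continuous_rlKernel {b : ℝ} (hb : 1 ≤ b) : Continuous (rlKernel b) := by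
  unfold rlKernel
  exact (Real.continuous_rpow_const (by linarith)).div_const _

lemma integral_exp_mul_rlKernel {b r : ℝ} (hb : 0 < b) (hr : 0 < r) :
    ∫ t in Ioi (0 : ℝ), Real.exp (-(r * t)) * rlKernel b t = (1 / r) ^ b := by
  have h := Real.integral_rpow_mul_exp_neg_mul_Ioi hb hr
  have hG := (Real.Gamma_pos_of_pos hb).ne'
  calc _ = ∫ t in Ioi (0 : ℝ), (t ^ (b - 1) * Real.exp (-(r * t))) / Real.Gamma b := by
        congr 1; ext t; rw [rlKernel]; ring
    _ = _ := by rw [integral_div, h]; field_simp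

lemma integrableOn_exp_mul_rlKernel {b r : ℝ} (hb : 0 < b) (hr : 0 < r) :
    IntegrableOn (fun t => Real.exp (-(r * t)) * rlKernel b t) (Ioi 0) := by
  -- The Bochner integral of a non-integrable function is `0` by convention, so a nonzero value
  -- proves integrability.
  refine Integrable.of_integral_ne_zero ?_
  rw [integral_exp_mul_rlKernel hb hr]
  positivity

/-- The Laplace transform of the Riemann-Liouville kernel. -/
lemma integral_cexp_mul_rlKernel {b : ℝ} (hb : 0 < b) {p : ℂ} (hp : 0 < p.re) :
    ∫ t in Ioi (0 : ℝ), Complex.exp (-(p * t)) * (rlKernel b t : ℂ) = p ^ (-b : ℂ) := by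
  -- With the kernel as density, the transform at `p` is the complex moment generating function at
  -- `-p`, hence analytic for `Re p > 0`. The identity theorem extends the formula from the real
  -- axis, where it is the Gamma integral.
  set μ : Measure ℝ := (volume.restrict (Ioi 0)).withDensity (fun t => ENNReal.ofReal (rlKernel b t))
    with hμ
  have hmeas : Measurable (fun t => ENNReal.ofReal (rlKernel b t)) :=
    (measurable_rlKernel b).ennreal_ofReal
  have hnn : ∀ᵐ t ∂(volume.restrict (Ioi (0 : ℝ))), 0 ≤ rlKernel b t := by
    filter_upwards [ae_restrict_mem measurableSet_Ioi] with t ht using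
      rlKernel_nonneg hb (le_of_lt ht)
  have hmgf : ∀ z : ℂ, ProbabilityTheory.complexMGF id μ z
      = ∫ t in Ioi (0 : ℝ), Complex.exp (z * t) * (rlKernel b t : ℂ) := by
    intro z
    rw [ProbabilityTheory.complexMGF, hμ, integral_withDensity_eq_integral_toReal_smul hmeas
      (Eventually.of_forall fun _ => ENNReal.ofReal_lt_top)]
    refine integral_congr_ae ?_
    filter_upwards [hnn] with t ht
    rw [ENNReal.toReal_ofReal ht, Complex.real_smul, mul_comm, id]
  have hset : Iio (0 : ℝ) ⊆ interior (ProbabilityTheory.integrableExpSet id μ) := by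
    refine interior_maximal (fun r hr => ?_) isOpen_Iio
    change Integrable _ _
    rw [hμ, integrable_withDensity_iff_integrable_smul' hmeas
      (Eventually.of_forall fun _ => ENNReal.ofReal_lt_top)]
    refine (integrableOn_exp_mul_rlKernel hb (neg_pos.2 hr)).congr ?_
    filter_upwards [hnn] with t ht
    rw [ENNReal.toReal_ofReal ht, smul_eq_mul, mul_comm, id]; simp
  set U : Set ℂ := {z | z.re < 0} with hU
  have hUo : IsOpen U := isOpen_lt Complex.continuous_re continuous_const
  have hUc : IsPreconnected U := (convex_halfSpace_re_lt 0).isPreconnected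
  have hf : AnalyticOnNhd ℂ (ProbabilityTheory.complexMGF id μ) U :=
    ProbabilityTheory.analyticOnNhd_complexMGF.mono fun z hz => hset hz
  have hg : AnalyticOnNhd ℂ (fun z : ℂ => (-z) ^ (-b : ℂ)) U := by
    refine DifferentiableOn.analyticOnNhd (fun z hz => ?_) hUo
    refine (DifferentiableAt.cpow_const (by fun_prop) ?_).differentiableWithinAt
    left; simpa [hU] using hz
  have hreal : ∀ r : ℝ, r < 0 →
      ProbabilityTheory.complexMGF id μ (r : ℂ) = (-(r : ℂ)) ^ (-b : ℂ) := by
    intro r hr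
    rw [hmgf]
    have h := integral_exp_mul_rlKernel hb (neg_pos.2 hr)
    have e : ∀ t : ℝ, Complex.exp (r * t) * (rlKernel b t : ℂ)
        = ((Real.exp (-(-r * t)) * rlKernel b t : ℝ) : ℂ) := by
      intro t; push_cast; congr 2; ring
    simp_rw [e]
    rw [integral_complex_ofReal, h, ← Complex.ofReal_neg, ← Complex.ofReal_neg b,
      ← Complex.ofReal_cpow (by linarith), Real.rpow_neg (by linarith), one_div,
      Real.inv_rpow (by linarith)]
  have hfreq : ∃ᶠ z in 𝓝[≠] (-1 : ℂ),
      ProbabilityTheory.complexMGF id μ z = (fun z : ℂ => (-z) ^ (-b : ℂ)) z := by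
    have ht : Tendsto (fun r : ℝ => (r : ℂ)) (𝓝[≠] (-1 : ℝ)) (𝓝[≠] (-1 : ℂ)) := by
      refine tendsto_nhdsWithin_iff.2 ⟨?_, ?_⟩
      · have := (Complex.continuous_ofReal.tendsto (-1 : ℝ))
        push_cast at this
        exact this.mono_left nhdsWithin_le_nhds
      · filter_upwards [self_mem_nhdsWithin] with r hr
        intro h; apply hr
        simp only [mem_singleton_iff] at h ⊢
        exact_mod_cast h
    refine ht.frequently (Eventually.frequently ?_)
    filter_upwards [nhdsWithin_le_nhds (Iio_mem_nhds (by norm_num : (-1 : ℝ) < 0))] with r hr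
      using hreal r hr
  have := hf.eqOn_of_preconnected_of_frequently_eq hg hUc (by simp [hU]) hfreq
    (show -p ∈ U by simpa [hU] using hp)
  simp only [neg_neg] at this
  rw [← this, hmgf]
  simp

lemma integrableOn_cexp_mul_rlKernel {b : ℝ} (hb : 0 < b) {p : ℂ} (hp : 0 < p.re) :
    IntegrableOn (fun t : ℝ => Complex.exp (-(p * t)) * (rlKernel b t : ℂ)) (Ioi 0) := by
  refine Integrable.of_integral_ne_zero ?_
  rw [integral_cexp_mul_rlKernel hb hp]
  have : p ≠ 0 := by rintro rfl; simp at hp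
  simp [Complex.cpow_eq_zero_iff, this]

variable {V : Type*} [NormedAddCommGroup V] [NormedSpace ℂ V]

/-- The Laplace transform. -/
def laplace (f : ℝ → V) (p : ℂ) : V := ∫ t in Ioi (0 : ℝ), Complex.exp (-(p * t)) • f t

/-- Splitting `e^{-pt} = e^{-p(t-τ)} e^{-pτ}` exhibits the weighted integral as a convolution on the
half-line, to which `integrable_posConvolution` and `integral_posConvolution` apply. -/
lemma cexp_smul_rlIntegral (b : ℝ) (f : ℝ → V) (p : ℂ) (t : ℝ) :
    Complex.exp (-(p * t)) • rlIntegral b f t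
      = ∫ τ in (0 : ℝ)..t, (ContinuousLinearMap.lsmul ℝ ℂ : ℂ →L[ℝ] V →L[ℝ] V).flip
          (Complex.exp (-(p * τ)) • f τ)
          (Complex.exp (-(p * (t - τ : ℝ))) * (rlKernel b (t - τ) : ℂ)) := by
  rw [rlIntegral, ← intervalIntegral.integral_smul]
  refine intervalIntegral.integral_congr fun τ _ => ?_
  simp only [ContinuousLinearMap.flip_apply, ContinuousLinearMap.lsmul_apply]
  rw [← Complex.coe_smul, smul_smul, smul_smul]
  congr 1
  have : Complex.exp (-(p * t)) = Complex.exp (-(p * (t - τ : ℝ))) * Complex.exp (-(p * τ)) := by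
    rw [← Complex.exp_add]; congr 1; push_cast; ring
  rw [this]; ring

lemma integrableOn_cexp_smul_rlIntegral {b : ℝ} (hb : 0 < b) {f : ℝ → V} {p : ℂ} (hp : 0 < p.re)
    (hf : IntegrableOn (fun t : ℝ => Complex.exp (-(p * t)) • f t) (Ioi 0)) :
    IntegrableOn (fun t : ℝ => Complex.exp (-(p * t)) • rlIntegral b f t) (Ioi 0) := by
  simp_rw [cexp_smul_rlIntegral]
  have h := integrable_posConvolution (ν := volume) (μ := volume) hf
    (integrableOn_cexp_mul_rlKernel hb hp)
    (ContinuousLinearMap.lsmul ℝ ℂ : ℂ →L[ℝ] V →L[ℝ] V).flip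
  exact (integrable_indicator_iff measurableSet_Ioi).1 h

/-- Solutions of the Volterra equation grow at most exponentially. -/
lemma exists_exp_bound_of_volterra {α : ℝ} (hα : 1 < α) (N : V →L[ℂ] V) {z : ℝ → V} {z₁ : V}
    (hc : ContinuousOn z (Ici 0))
    (h : ∀ t, 0 < t → z t = z 0 + t • z₁ + rlIntegral α (fun s => N (z s)) t) :
    ∃ C a : ℝ, 0 < a ∧ ∀ t, 0 ≤ t → ‖z t‖ ≤ C * Real.exp (a * t) := by
  have hα0 : 0 < α := by linarith
  -- With this `a`, the operator `I^α N` has norm at most `1/2` for the sup norm weighted by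
  -- `e^{-at}`.
  obtain ⟨a, ha1, ha⟩ : ∃ a : ℝ, 1 ≤ a ∧ ‖N‖ * (1 / a) ^ α ≤ 1 / 2 := by
    have ht : Tendsto (fun a : ℝ => ‖N‖ * (1 / a) ^ α) atTop (𝓝 (‖N‖ * 0 ^ α)) := by
      refine Tendsto.const_mul _ (Tendsto.rpow_const ?_ (Or.inr hα0.le))
      exact (tendsto_inv_atTop_zero (𝕜 := ℝ)).congr fun x => (one_div x).symm
    rw [Real.zero_rpow hα0.ne', mul_zero] at ht
    exact ((eventually_ge_atTop 1).and (ht.eventually_le_const (by norm_num))).exists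
  have ha0 : 0 < a := by linarith
  have hker : ∀ t, 0 ≤ t → ∫ τ in (0 : ℝ)..t, rlKernel α (t - τ) * Real.exp (a * τ)
      ≤ (1 / a) ^ α * Real.exp (a * t) := by
    intro t ht
    have e : ∫ τ in (0 : ℝ)..t, rlKernel α (t - τ) * Real.exp (a * τ)
        = Real.exp (a * t) * ∫ u in (0 : ℝ)..t, Real.exp (-(a * u)) * rlKernel α u := by
      have := intervalIntegral.integral_comp_sub_left (a := 0) (b := t)
        (fun u => Real.exp (-(a * u)) * rlKernel α u) t
      rw [sub_self, sub_zero] at this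
      rw [← this, ← intervalIntegral.integral_const_mul]
      refine intervalIntegral.integral_congr fun τ _ => ?_
      rw [← mul_assoc, ← Real.exp_add, mul_comm]
      congr 2; ring
    rw [e, mul_comm, ← integral_exp_mul_rlKernel hα0 ha0, intervalIntegral.integral_of_le ht]
    refine mul_le_mul_of_nonneg_right ?_ (Real.exp_pos _).le
    refine setIntegral_mono_set (integrableOn_exp_mul_rlKernel hα0 ha0) ?_
      Ioc_subset_Ioi_self.eventuallyLE
    filter_upwards [ae_restrict_mem measurableSet_Ioi] with x hx
    exact mul_nonneg (Real.exp_pos _).le (rlKernel_nonneg hα0 (le_of_lt hx))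
  refine ⟨2 * (‖z 0‖ + ‖z₁‖), a, ha0, fun T hT => ?_⟩
  -- At a maximum point of the weighted norm on `[0, T]` the equation gives `m ≤ ‖z 0‖ + ‖z₁‖ + m /
  -- 2`. Absorbing `m / 2` yields a bound independent of `T`.
  obtain ⟨s, hs, hmax⟩ := isCompact_Icc.exists_isMaxOn (nonempty_Icc.2 hT)
    (f := fun t => ‖z t‖ * Real.exp (-(a * t)))
    ((hc.mono Icc_subset_Ici_self).norm.mul (by fun_prop))
  set m := ‖z s‖ * Real.exp (-(a * s)) with hm
  have hmt : ∀ t ∈ Icc 0 T, ‖z t‖ ≤ m * Real.exp (a * t) := by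
    intro t ht
    have h1 : ‖z t‖ * Real.exp (-(a * t)) ≤ m := hmax ht
    calc ‖z t‖ = ‖z t‖ * Real.exp (-(a * t)) * Real.exp (a * t) := by
          rw [mul_assoc, ← Real.exp_add]; simp
      _ ≤ _ := mul_le_mul_of_nonneg_right h1 (Real.exp_pos _).le
  have hm0 : 0 ≤ m := by positivity
  have hmC : m ≤ 2 * (‖z 0‖ + ‖z₁‖) := by
    rcases hs.1.eq_or_lt with h0 | h0
    · rw [hm, ← h0]; simp only [mul_zero, neg_zero, Real.exp_zero, mul_one]
      nlinarith [norm_nonneg (z 0), norm_nonneg z₁]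
    have hint : ‖rlIntegral α (fun s => N (z s)) s‖ ≤ 1 / 2 * m * Real.exp (a * s) := by
      have h1 : ‖rlIntegral α (fun s => N (z s)) s‖
          ≤ ∫ τ in (0 : ℝ)..s, (‖N‖ * m) * (rlKernel α (s - τ) * Real.exp (a * τ)) := by
        refine intervalIntegral.norm_integral_le_of_norm_le h0.le ?_ ?_
        · refine Eventually.of_forall fun τ hτ => ?_
          rw [norm_smul, Real.norm_of_nonneg (rlKernel_nonneg hα0 (sub_nonneg.2 hτ.2))]
          have h2 := hmt τ ⟨hτ.1.le, hτ.2.trans hs.2⟩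
          have h3 := (N.le_opNorm (z τ)).trans (mul_le_mul_of_nonneg_left h2 (norm_nonneg N))
          calc _ ≤ rlKernel α (s - τ) * (‖N‖ * (m * Real.exp (a * τ))) :=
                mul_le_mul_of_nonneg_left h3 (rlKernel_nonneg hα0 (sub_nonneg.2 hτ.2))
            _ = _ := by ring
        · refine Continuous.intervalIntegrable ?_ _ _
          have := continuous_rlKernel hα.le
          fun_prop
      rw [intervalIntegral.integral_const_mul] at h1
      refine h1.trans ?_
      calc _ ≤ (‖N‖ * m) * ((1 / a) ^ α * Real.exp (a * s)) :=
            mul_le_mul_of_nonneg_left (hker s h0.le) (by positivity)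
        _ = (‖N‖ * (1 / a) ^ α) * (m * Real.exp (a * s)) := by ring
        _ ≤ 1 / 2 * (m * Real.exp (a * s)) := mul_le_mul_of_nonneg_right ha (by positivity)
        _ = _ := by ring
    have hz : ‖z s‖ ≤ ‖z 0‖ + s * ‖z₁‖ + 1 / 2 * m * Real.exp (a * s) := by
      rw [h s h0]
      refine (norm_add_le _ _).trans (add_le_add ((norm_add_le _ _).trans (add_le_add le_rfl ?_)) hint)
      rw [norm_smul, Real.norm_of_nonneg h0.le]
    have hes : 1 ≤ Real.exp (a * s) := Real.one_le_exp (by positivity)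
    have hse : s ≤ Real.exp (a * s) := by
      have := Real.add_one_le_exp (a * s); nlinarith
    have hfin : ‖z s‖ ≤ (‖z 0‖ + ‖z₁‖ + 1 / 2 * m) * Real.exp (a * s) := by
      nlinarith [norm_nonneg (z 0), norm_nonneg z₁]
    have : m ≤ ‖z 0‖ + ‖z₁‖ + 1 / 2 * m := by
      calc m ≤ (‖z 0‖ + ‖z₁‖ + 1 / 2 * m) * Real.exp (a * s) * Real.exp (-(a * s)) :=
            mul_le_mul_of_nonneg_right hfin (Real.exp_pos _).le
        _ = _ := by rw [mul_assoc, ← Real.exp_add]; simp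
    linarith
  exact (hmt T ⟨hT, le_rfl⟩).trans (mul_le_mul_of_nonneg_right hmC (Real.exp_pos _).le)

variable [CompleteSpace V]

lemma laplace_rlIntegral {b : ℝ} (hb : 0 < b) {f : ℝ → V} {p : ℂ} (hp : 0 < p.re)
    (hf : IntegrableOn (fun t : ℝ => Complex.exp (-(p * t)) • f t) (Ioi 0)) :
    laplace (rlIntegral b f) p = p ^ (-b : ℂ) • laplace f p := by
  rw [laplace]
  simp_rw [cexp_smul_rlIntegral]
  rw [integral_posConvolution hf (integrableOn_cexp_mul_rlKernel hb hp),
    integral_cexp_mul_rlKernel hb hp]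
  rfl

/-- The Laplace transform of the solution of the Volterra equation `z = z₀ + t z₁ + I^α (N z)`. -/
lemma laplace_volterra {α : ℝ} (hα : 0 < α) (N : V →L[ℂ] V) {z : ℝ → V} {z₀ z₁ : V}
    (h : ∀ t, 0 < t → z t = z₀ + t • z₁ + rlIntegral α (fun s => N (z s)) t)
    {p : ℂ} (hp : 0 < p.re)
    (hz : IntegrableOn (fun t : ℝ => Complex.exp (-(p * t)) • z t) (Ioi 0)) :
    p ^ (α : ℂ) • laplace z p
      = p ^ (α - 1 : ℂ) • z₀ + p ^ (α - 2 : ℂ) • z₁ + N (laplace z p) := by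
  have hp0 : p ≠ 0 := by rintro rfl; simp at hp
  have hNz : IntegrableOn (fun t : ℝ => Complex.exp (-(p * t)) • N (z t)) (Ioi 0) := by
    have := N.integrable_comp hz
    simp only [map_smul] at this
    exact this
  have hNl : laplace (fun s => N (z s)) p = N (laplace z p) := by
    rw [laplace, laplace, ← N.integral_comp_comm hz]; simp
  have h1 := integrableOn_cexp_mul_rlKernel one_pos hp
  have h2 := integrableOn_cexp_mul_rlKernel two_pos hp
  have h12 : IntegrableOn (fun t : ℝ => (Complex.exp (-(p * t)) * (rlKernel 1 t : ℂ)) • z₀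
      + (Complex.exp (-(p * t)) * (rlKernel 2 t : ℂ)) • z₁) (Ioi 0) :=
    (h1.smul_const _).add (h2.smul_const _)
  have e : laplace z p = p ^ (-(1 : ℝ) : ℂ) • z₀ + p ^ (-(2 : ℝ) : ℂ) • z₁
      + p ^ (-α : ℂ) • N (laplace z p) := by
    rw [← hNl, ← laplace_rlIntegral hα hp hNz, ← integral_cexp_mul_rlKernel one_pos hp,
      ← integral_cexp_mul_rlKernel two_pos hp, ← integral_smul_const, ← integral_smul_const,
      laplace, laplace, ← integral_add (h1.smul_const _) (h2.smul_const _),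
      ← integral_add h12
        (integrableOn_cexp_smul_rlIntegral hα hp hNz)]
    refine setIntegral_congr_fun measurableSet_Ioi fun t ht => ?_
    rw [h t ht, rlKernel_one, rlKernel_two]
    simp [smul_add, mul_smul]
  have e2 := congrArg (fun v => p ^ (α : ℂ) • v) e
  simp only [smul_add, smul_smul, ← Complex.cpow_add _ _ hp0] at e2
  rw [e2]
  simp [sub_eq_add_neg]

end

/-! ### Contour shifts and resolvent bounds in the closed right half-plane -/

section

lemma arg_cpow_of_abs_lt {p : ℂ} (hp : p ≠ 0) {a : ℝ} (h : |a * p.arg| < Real.pi) :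
    (p ^ (a : ℂ)).arg = a * p.arg := by
  have him : (Complex.log p * a).im = a * p.arg := by
    rw [Complex.im_mul_ofReal, Complex.log_im, mul_comm]
  rw [abs_lt] at h
  rw [← Complex.log_im, Complex.cpow_def_of_ne_zero hp, Complex.log_exp, him]
  · rw [him]; exact h.1
  · rw [him]; exact h.2.le

/-- Raising to the power `a` multiplies the argument by `a`. Since `a < 2`, the result stays below
`π` in absolute value and does not wrap around. -/
lemma abs_arg_cpow_le {p : ℂ} (hp : 0 ≤ p.re) {a : ℝ} (ha₀ : 0 < a) (ha : a < 2) :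
    |(p ^ (a : ℂ)).arg| ≤ a * Real.pi / 2 := by
  rcases eq_or_ne p 0 with rfl | h0
  · rw [Complex.zero_cpow (by exact_mod_cast ha₀.ne')]
    simp; positivity
  have h1 : |p.arg| ≤ Real.pi / 2 := Complex.abs_arg_le_pi_div_two_iff.2 hp
  have h2 : |a * p.arg| ≤ a * Real.pi / 2 := by
    rw [abs_mul, abs_of_pos ha₀]; nlinarith
  rw [arg_cpow_of_abs_lt h0]
  · exact h2
  · refine h2.trans_lt ?_; nlinarith [Real.pi_pos]

/-- A decreasing function with `cutoff β |·|` integrable on `ℝ` for `-1 < β ≤ 0`. -/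
def cutoff (β r : ℝ) : ℝ := min (r ^ β) (r ^ (-2 : ℝ))

lemma cutoff_nonneg (β : ℝ) {r : ℝ} (hr : 0 ≤ r) : 0 ≤ cutoff β r :=
  le_min (Real.rpow_nonneg hr _) (Real.rpow_nonneg hr _)

lemma cutoff_anti {β r s : ℝ} (hβ : β ≤ 0) (hr : 0 < r) (hrs : r ≤ s) :
    cutoff β s ≤ cutoff β r :=
  min_le_min (Real.rpow_le_rpow_of_nonpos hr hrs hβ)
    (Real.rpow_le_rpow_of_nonpos hr hrs (by norm_num))

lemma integrable_cutoff_abs {β : ℝ} (hβ : -1 < β) : Integrable (fun ω : ℝ => cutoff β |ω|) := by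
  have hm : Measurable (cutoff β) := by unfold cutoff; fun_prop
  have h1 : IntegrableOn (cutoff β) (Ioi 0) := by
    rw [← Ioc_union_Ioi_eq_Ioi zero_le_one]
    refine IntegrableOn.union ?_ ?_
    · refine Integrable.mono' ((intervalIntegrable_iff_integrableOn_Ioc_of_le zero_le_one).1
        (intervalIntegral.intervalIntegrable_rpow' hβ)) hm.aestronglyMeasurable ?_
      filter_upwards [ae_restrict_mem measurableSet_Ioc] with x hx
      rw [Real.norm_of_nonneg (cutoff_nonneg β hx.1.le)]
      exact min_le_left _ _
    · refine Integrable.mono' (integrableOn_Ioi_rpow_of_lt (by norm_num : (-2 : ℝ) < -1) one_pos)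
        hm.aestronglyMeasurable ?_
      filter_upwards [ae_restrict_mem measurableSet_Ioi] with x hx
      rw [Real.norm_of_nonneg (cutoff_nonneg β (zero_le_one.trans (le_of_lt hx)))]
      exact min_le_right _ _
  have h2 : IntegrableOn (fun ω : ℝ => cutoff β |ω|) (Ioi 0) :=
    h1.congr_fun (fun x hx => by rw [abs_of_pos hx]) measurableSet_Ioi
  have h3 : IntegrableOn (fun ω : ℝ => cutoff β |ω|) (Iio 0) := by
    have := h2.comp_neg
    simpa using this
  rw [← integrableOn_univ, ← Iio_union_Ici (a := (0 : ℝ))]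
  exact h3.union ((integrableOn_Ici_iff_integrableOn_Ioi).2 h2)

variable {V : Type*} [NormedAddCommGroup V] [NormedSpace ℂ V]

/-- Shifting the line of integration of a holomorphic function that decays at `± i ∞`. -/
lemma integral_vertical_eq {F : ℂ → V} {σ₁ σ₂ : ℝ} (h12 : σ₁ ≤ σ₂) {B : ℝ → ℝ}
    (hF : ∀ p : ℂ, σ₁ ≤ p.re → p.re ≤ σ₂ → DifferentiableAt ℂ F p)
    (hB : Tendsto B atTop (𝓝 0))
    (hFB : ∀ p : ℂ, σ₁ ≤ p.re → p.re ≤ σ₂ → ‖F p‖ ≤ B |p.im|)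
    (h₁ : Integrable fun ω : ℝ => F (σ₁ + ω * Complex.I))
    (h₂ : Integrable fun ω : ℝ => F (σ₂ + ω * Complex.I)) :
    ∫ ω : ℝ, F (σ₁ + ω * Complex.I) = ∫ ω : ℝ, F (σ₂ + ω * Complex.I) := by
  have hrect : ∀ T : ℝ,
      (∫ x : ℝ in σ₁..σ₂, F (x + (-T : ℝ) * Complex.I))
      - (∫ x : ℝ in σ₁..σ₂, F (x + (T : ℝ) * Complex.I))
      + Complex.I • (∫ y : ℝ in (-T)..T, F (σ₂ + y * Complex.I))
      - Complex.I • (∫ y : ℝ in (-T)..T, F (σ₁ + y * Complex.I)) = 0 := by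
    intro T
    have := Complex.integral_boundary_rect_eq_zero_of_differentiableOn F ⟨σ₁, -T⟩ ⟨σ₂, T⟩
      (fun p hp => by
        have h := hp.1
        rw [uIcc_of_le h12] at h
        exact (hF p h.1 h.2).differentiableWithinAt)
    simpa using this
  have hv : ∀ σ : ℝ, Integrable (fun ω : ℝ => F (σ + ω * Complex.I)) →
      Tendsto (fun T : ℝ => ∫ y : ℝ in (-T)..T, F (σ + y * Complex.I)) atTop
        (𝓝 (∫ ω : ℝ, F (σ + ω * Complex.I))) := fun σ h =>
    intervalIntegral_tendsto_integral h tendsto_neg_atTop_atBot tendsto_id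
  -- The sign `ε = ±1` treats the top and bottom edges of the rectangle together.
  have hh : ∀ ε : ℝ, |ε| = 1 → Tendsto
      (fun T : ℝ => ∫ x : ℝ in σ₁..σ₂, F (x + (ε * T : ℝ) * Complex.I)) atTop (𝓝 0) := by
    intro ε hε
    have hBl : Tendsto (fun T : ℝ => B T * |σ₂ - σ₁|) atTop (𝓝 0) := by
      simpa using hB.mul_const |σ₂ - σ₁|
    refine squeeze_zero_norm' ?_ hBl
    filter_upwards [eventually_ge_atTop 0] with T hT
    refine intervalIntegral.norm_integral_le_of_norm_le_const fun x hx => ?_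
    rw [uIoc_of_le h12] at hx
    have := hFB (x + (ε * T : ℝ) * Complex.I) (by simpa using hx.1.le) (by simpa using hx.2)
    simpa [abs_mul, hε, abs_of_nonneg hT] using this
  have h3 := (((hh (-1) (by simp)).sub (hh 1 (by simp))).add
    ((hv σ₂ h₂).const_smul Complex.I)).sub ((hv σ₁ h₁).const_smul Complex.I)
  simp only [neg_mul, one_mul] at h3
  have h4 := tendsto_nhds_unique h3 (tendsto_const_nhds.congr fun T => (hrect T).symm)
  simp only [sub_self, zero_add, sub_eq_zero] at h4
  exact (smul_right_injective V Complex.I_ne_zero h4).symm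

section Resolvent

variable {N : V →L[ℂ] V} {α : ℝ}

lemma cpow_mem_resolventSet (hα₀ : 0 < α) (hα₂ : α < 2)
    (hN : ∀ s ∈ spectrum ℂ N, α * Real.pi / 2 < |s.arg|) {p : ℂ} (hp : 0 ≤ p.re) :
    p ^ (α : ℂ) ∈ resolventSet ℂ N := by
  by_contra h
  exact (hN _ h).not_ge (abs_arg_cpow_le hp hα₀ hα₂)

/-- For large `p` this is `‖(s - N)⁻¹‖ = O(1 / |s|)` at `s = p^α`. On the remaining compact
half-disc the resolvent is continuous, including at `p = 0`, since `arg 0 = 0` keeps `0` out of the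
spectrum. -/
lemma exists_norm_resolvent_le [CompleteSpace V] (hα₁ : 1 < α) (hα₂ : α < 2)
    (hN : ∀ s ∈ spectrum ℂ N, α * Real.pi / 2 < |s.arg|) :
    ∃ C : ℝ, 0 ≤ C ∧ ∀ p : ℂ, 0 ≤ p.re →
      (1 + ‖p‖ ^ α) * ‖resolvent N (p ^ (α : ℂ))‖ ≤ C := by
  have hα₀ : 0 < α := by linarith
  obtain ⟨c, hc⟩ := (spectrum.resolvent_isBigO_inv (𝕜 := ℂ) N).bound
  obtain ⟨R, hR⟩ : ∃ R : ℝ, ∀ s : ℂ, R ≤ ‖s‖ → ‖resolvent N s‖ ≤ c * ‖s⁻¹‖ := by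
    obtain ⟨R, -, hR⟩ := (hasBasis_cobounded_norm (E := ℂ)).eventually_iff.1 hc
    exact ⟨R, fun s hs => hR hs⟩
  set R' := max R 1 with hR'
  set K : Set ℂ := {p | 0 ≤ p.re} ∩ Metric.closedBall 0 R' with hK
  have hKc : IsCompact K :=
    (isCompact_closedBall 0 R').inter_left (isClosed_le continuous_const Complex.continuous_re)
  have hcont : ContinuousOn (fun p : ℂ => (1 + ‖p‖ ^ α) * ‖resolvent N (p ^ (α : ℂ))‖) K := by
    intro p hp
    have h1 : ContinuousAt (fun p : ℂ => p ^ (α : ℂ)) p :=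
      Complex.continuousAt_cpow_const_of_re_pos (Or.inl hp.1) (by simpa using hα₀)
    have h2 : ContinuousAt (fun p : ℂ => resolvent N (p ^ (α : ℂ))) p :=
      ContinuousAt.comp (g := resolvent N) (spectrum.hasDerivAt_resolvent_const_left
        (cpow_mem_resolventSet hα₀ hα₂ hN hp.1)).continuousAt h1
    refine ContinuousAt.continuousWithinAt (ContinuousAt.mul ?_ h2.norm)
    exact continuousAt_const.add (continuous_norm.continuousAt.rpow_const (Or.inr hα₀.le))
  obtain ⟨C, hC⟩ := hKc.bddAbove_image hcont
  refine ⟨max (2 * |c|) (max C 0), by positivity, fun p hp => ?_⟩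
  by_cases hpR : ‖p‖ ≤ R'
  · exact (hC (mem_image_of_mem _ ⟨hp, by simpa using hpR⟩)).trans
      ((le_max_left _ _).trans (le_max_right _ _))
  · push Not at hpR
    have h1 : 1 < ‖p‖ := (le_max_right _ _).trans_lt hpR
    have h2 : ‖p‖ ≤ ‖p‖ ^ α := Real.self_le_rpow_of_one_le h1.le hα₁.le
    have h3 := hR (p ^ (α : ℂ)) (by
      rw [Complex.norm_cpow_real]; exact (le_max_left R 1).trans (hpR.le.trans h2))
    rw [norm_inv, Complex.norm_cpow_real] at h3
    refine le_trans ?_ (le_max_left _ _)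
    have hpos : 0 < ‖p‖ ^ α := by linarith
    calc (1 + ‖p‖ ^ α) * ‖resolvent N (p ^ (α : ℂ))‖
        ≤ (2 * ‖p‖ ^ α) * (|c| * (‖p‖ ^ α)⁻¹) := by
          refine mul_le_mul (by linarith) (h3.trans ?_) (norm_nonneg _) (by positivity)
          exact mul_le_mul_of_nonneg_right (le_abs_self c) (by positivity)
      _ = 2 * |c| := by field_simp

/-- The Laplace transform of `z - e^{-t} z₀`, where `z` solves `D^α z = N z` with initial values
`z₀` and `z₁`. -/
def laplaceSol (N : V →L[ℂ] V) (α : ℝ) (z₀ z₁ : V) (p : ℂ) : V :=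
  resolvent N (p ^ (α : ℂ)) (p ^ (α - 1 : ℂ) • z₀ + p ^ (α - 2 : ℂ) • z₁) - (p + 1)⁻¹ • z₀

/-- Expands the resolvent one step at infinity, isolating the leading term `v / s`. -/
lemma resolvent_smul_apply {s : ℂ} (hs : s ∈ resolventSet ℂ N) (v : V) :
    s • resolvent N s v = v + resolvent N s (N v) := by
  have h : resolvent N s * (algebraMap ℂ (V →L[ℂ] V) s - N) = 1 :=
    Ring.inverse_mul_cancel _ hs
  have h2 := congrArg (fun T : V →L[ℂ] V => T v) h
  simp only [mul_apply_eq_comp, sub_apply,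
    Algebra.algebraMap_eq_smul_one, smul_apply,
    one_apply_eq_self, map_sub, map_smul] at h2
  rw [← sub_eq_iff_eq_add]; exact h2

lemma resolvent_apply_sub {s : ℂ} (hs : s ∈ resolventSet ℂ N) (v : V) :
    resolvent N s (s • v - N v) = v := by
  rw [map_sub, map_smul, resolvent_smul_apply hs]; simp

lemma mem_slitPlane_of_re_nonneg {p : ℂ} (hp : 0 ≤ p.re) (h0 : p ≠ 0) : p ∈ Complex.slitPlane := by
  rw [Complex.mem_slitPlane_iff]
  by_contra! h
  exact h0 (Complex.ext (le_antisymm h.1 hp) h.2)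

lemma differentiableAt_laplaceSol [CompleteSpace V] (hα₀ : 0 < α) (hα₂ : α < 2)
    (hN : ∀ s ∈ spectrum ℂ N, α * Real.pi / 2 < |s.arg|) (z₀ z₁ : V) {p : ℂ} (hp : 0 ≤ p.re)
    (h0 : p ≠ 0) : DifferentiableAt ℂ (laplaceSol N α z₀ z₁) p := by
  have hsl := mem_slitPlane_of_re_nonneg hp h0
  have h1 : ∀ c : ℂ, DifferentiableAt ℂ (fun p : ℂ => p ^ c) p := fun c =>
    differentiableAt_id.cpow_const hsl
  have h2 : DifferentiableAt ℂ (fun p : ℂ => resolvent N (p ^ (α : ℂ))) p :=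
    DifferentiableAt.comp (g := resolvent N) p (spectrum.hasDerivAt_resolvent_const_left
      (cpow_mem_resolventSet hα₀ hα₂ hN hp)).differentiableAt (h1 _)
  have h3 : p + 1 ≠ 0 := by
    intro h
    have := congrArg Complex.re h
    simp at this; linarith
  have h4 : DifferentiableAt ℂ (fun p : ℂ => (p + 1)⁻¹) p :=
    DifferentiableAt.fun_inv (by fun_prop) h3
  exact (h2.clm_apply (((h1 _).smul_const _).add ((h1 _).smul_const _))).sub
    (h4.smul_const _)

/-- Near `0` the resolvent is bounded and `p^(α-2)` dominates. At infinity the resolvent is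
`O(|p|^(-α))`, which settles the `z₁` term; the `z₀` term alone is only `O(1 / |p|)`, and the
subtracted `(p + 1)⁻¹ z₀` cancels its leading part. -/
lemma exists_norm_laplaceSol_le [CompleteSpace V] (hα₁ : 1 < α) (hα₂ : α < 2)
    (hN : ∀ s ∈ spectrum ℂ N, α * Real.pi / 2 < |s.arg|) (z₀ z₁ : V) :
    ∃ C : ℝ, 0 ≤ C ∧ ∀ p : ℂ, 0 ≤ p.re → p ≠ 0 →
      ‖laplaceSol N α z₀ z₁ p‖ ≤ C * cutoff (α - 2) ‖p‖ := by
  obtain ⟨C, hC0, hC⟩ := exists_norm_resolvent_le hα₁ hα₂ hN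
  have hα₀ : 0 < α := by linarith
  refine ⟨(C + 1) * (‖z₀‖ + ‖N z₀‖ + ‖z₁‖), by positivity, fun p hp h0 => ?_⟩
  have hp0 : 0 < ‖p‖ := norm_pos_iff.2 h0
  have hR := hC p hp
  set R := resolvent N (p ^ (α : ℂ)) with hRdef
  have hpα : 0 < ‖p‖ ^ α := Real.rpow_pos_of_pos hp0 _
  have hn1 : ‖p ^ (α - 1 : ℂ)‖ = ‖p‖ ^ (α - 1) := by
    rw [← Complex.norm_cpow_real]; push_cast; rfl
  have hn2 : ‖p ^ (α - 2 : ℂ)‖ = ‖p‖ ^ (α - 2) := by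
    rw [← Complex.norm_cpow_real]; push_cast; rfl
  have hp1 : ‖p‖ ≤ ‖p + 1‖ ∧ 1 ≤ ‖p + 1‖ := by
    constructor
    · rw [Complex.norm_def, Complex.norm_def]
      refine Real.sqrt_le_sqrt ?_
      simp only [Complex.normSq_apply, Complex.add_re, Complex.one_re, Complex.add_im,
        Complex.one_im]
      nlinarith
    · refine le_trans ?_ (Complex.re_le_norm _)
      simpa using hp
  rcases le_or_gt ‖p‖ 1 with h1 | h1
  · have hcut : cutoff (α - 2) ‖p‖ = ‖p‖ ^ (α - 2) :=
      min_eq_left (Real.rpow_le_rpow_of_exponent_ge hp0 h1 (by linarith))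
    have hR1 : ‖R‖ ≤ C := by nlinarith [norm_nonneg R]
    have e1 : ‖p‖ ^ (α - 1) ≤ ‖p‖ ^ (α - 2) :=
      Real.rpow_le_rpow_of_exponent_ge hp0 h1 (by linarith)
    have e2 : 1 ≤ ‖p‖ ^ (α - 2) := Real.one_le_rpow_of_pos_of_le_one_of_nonpos hp0 h1 (by linarith)
    rw [hcut]
    set b := ‖p‖ ^ (α - 2) with hb
    have t1 : ‖R (p ^ (α - 1 : ℂ) • z₀ + p ^ (α - 2 : ℂ) • z₁)‖ ≤ C * (b * ‖z₀‖ + b * ‖z₁‖) := by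
      refine (R.le_opNorm _).trans (mul_le_mul hR1 ?_ (norm_nonneg _) hC0)
      refine (norm_add_le _ _).trans ?_
      rw [norm_smul, norm_smul, hn1, hn2]
      gcongr
    have t2 : ‖(p + 1)⁻¹ • z₀‖ ≤ b * ‖z₀‖ := by
      rw [norm_smul, norm_inv]
      refine mul_le_mul_of_nonneg_right ?_ (norm_nonneg _)
      exact (inv_le_one_of_one_le₀ hp1.2).trans e2
    calc _ ≤ C * (b * ‖z₀‖ + b * ‖z₁‖) + b * ‖z₀‖ := (norm_sub_le _ _).trans (add_le_add t1 t2)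
      _ = b * (C * (‖z₀‖ + ‖z₁‖) + ‖z₀‖) := by ring
      _ ≤ b * ((C + 1) * (‖z₀‖ + ‖N z₀‖ + ‖z₁‖)) := by
          refine mul_le_mul_of_nonneg_left ?_ (by linarith)
          nlinarith [mul_nonneg hC0 (norm_nonneg (N z₀)), norm_nonneg (N z₀), norm_nonneg z₁]
      _ = _ := by ring
  · have hcut : cutoff (α - 2) ‖p‖ = ‖p‖ ^ (-2 : ℝ) :=
      min_eq_right (Real.rpow_le_rpow_of_exponent_le h1.le (by linarith))
    have hR1 : ‖R‖ ≤ C * ‖p‖ ^ (-α) := by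
      rw [Real.rpow_neg hp0.le, ← div_eq_mul_inv, le_div_iff₀ hpα]
      nlinarith [norm_nonneg R]
    have hres : p ^ (α : ℂ) ∈ resolventSet ℂ N := cpow_mem_resolventSet hα₀ hα₂ hN hp
    -- The leading term `p⁻¹ z₀` combines with `-(p + 1)⁻¹ z₀` to a term of order `|p|^(-2)`.
    have hsplit : p ^ (α - 1 : ℂ) • R z₀ = p⁻¹ • z₀ + p⁻¹ • R (N z₀) := by
      rw [Complex.cpow_sub _ _ h0, Complex.cpow_one, div_eq_mul_inv, mul_comm, mul_smul,
        resolvent_smul_apply hres, smul_add]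
    have hinv : p⁻¹ - (p + 1)⁻¹ = p⁻¹ * (p + 1)⁻¹ := by
      have h3 : p + 1 ≠ 0 := norm_pos_iff.1 (by linarith)
      field_simp; ring
    have hG : laplaceSol N α z₀ z₁ p
        = (p⁻¹ * (p + 1)⁻¹) • z₀ + p⁻¹ • R (N z₀) + p ^ (α - 2 : ℂ) • R z₁ := by
      rw [laplaceSol, map_add, map_smul, map_smul, ← hRdef, hsplit, ← hinv, sub_smul]
      abel
    rw [hG, hcut]
    set b := ‖p‖ ^ (-2 : ℝ) with hb
    have hb0 : 0 < b := Real.rpow_pos_of_pos hp0 _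
    have hbi : ‖p‖⁻¹ * ‖p‖⁻¹ = b := by
      rw [hb, Real.rpow_neg hp0.le, Real.rpow_two]; field_simp
    have t1 : ‖(p⁻¹ * (p + 1)⁻¹) • z₀‖ ≤ b * ‖z₀‖ := by
      rw [norm_smul, norm_mul, norm_inv, norm_inv, ← hbi]
      gcongr
      exact hp1.1
    have t2 : ‖p⁻¹ • R (N z₀)‖ ≤ b * (C * ‖N z₀‖) := by
      rw [norm_smul, norm_inv]
      have : ‖R (N z₀)‖ ≤ (C * ‖p‖⁻¹) * ‖N z₀‖ := by
        refine (R.le_opNorm _).trans (mul_le_mul_of_nonneg_right (hR1.trans ?_) (norm_nonneg _))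
        refine mul_le_mul_of_nonneg_left ?_ hC0
        rw [← Real.rpow_neg_one]
        exact Real.rpow_le_rpow_of_exponent_le h1.le (by linarith)
      calc _ ≤ ‖p‖⁻¹ * ((C * ‖p‖⁻¹) * ‖N z₀‖) := by gcongr
        _ = _ := by rw [← hbi]; ring
    have t3 : ‖p ^ (α - 2 : ℂ) • R z₁‖ ≤ b * (C * ‖z₁‖) := by
      rw [norm_smul, hn2]
      have : ‖R z₁‖ ≤ (C * ‖p‖ ^ (-α)) * ‖z₁‖ :=
        (R.le_opNorm _).trans (mul_le_mul_of_nonneg_right hR1 (norm_nonneg _))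
      calc _ ≤ ‖p‖ ^ (α - 2) * ((C * ‖p‖ ^ (-α)) * ‖z₁‖) := by gcongr
        _ = (‖p‖ ^ (α - 2) * ‖p‖ ^ (-α)) * (C * ‖z₁‖) := by ring
        _ = _ := by rw [← Real.rpow_add hp0, hb]; ring_nf
    calc _ ≤ b * ‖z₀‖ + b * (C * ‖N z₀‖) + b * (C * ‖z₁‖) :=
          (norm_add₃_le).trans (add_le_add (add_le_add t1 t2) t3)
      _ = b * (‖z₀‖ + C * ‖N z₀‖ + C * ‖z₁‖) := by ring
      _ ≤ b * ((C + 1) * (‖z₀‖ + ‖N z₀‖ + ‖z₁‖)) := by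
          refine mul_le_mul_of_nonneg_left ?_ hb0.le
          nlinarith [mul_nonneg hC0 (norm_nonneg z₀), norm_nonneg (N z₀), norm_nonneg z₁]
      _ = _ := by ring

end Resolvent

end

/-! ### Laplace inversion and decay -/

section

variable {V : Type*} [NormedAddCommGroup V] [NormedSpace ℂ V]

lemma integrableOn_cexp_smul_of_exp_bound {f : ℝ → V} (hc : ContinuousOn f (Ici 0)) {C a : ℝ}
    (hf : ∀ t, 0 ≤ t → ‖f t‖ ≤ C * Real.exp (a * t)) {p : ℂ} (hp : a < p.re) :
    IntegrableOn (fun t : ℝ => Complex.exp (-(p * t)) • f t) (Ioi 0) := by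
  have h1 : IntegrableOn (fun t : ℝ => C * Real.exp (-(p.re - a) * t)) (Ioi 0) :=
    (exp_neg_integrableOn_Ioi 0 (sub_pos.2 hp)).const_mul C
  refine Integrable.mono' h1 ?_ ?_
  · refine ContinuousOn.aestronglyMeasurable ?_ measurableSet_Ioi
    exact ContinuousOn.smul (by fun_prop) (hc.mono Ioi_subset_Ici_self)
  · filter_upwards [ae_restrict_mem measurableSet_Ioi] with t ht
    rw [norm_smul, Complex.norm_exp]
    have h2 := hf t (le_of_lt ht)
    calc _ ≤ Real.exp (-(p * t)).re * (C * Real.exp (a * t)) := by gcongr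
      _ = C * (Real.exp (-(p.re * t)) * Real.exp (a * t)) := by simp; ring
      _ = _ := by rw [← Real.exp_add]; congr 2; ring

/-- The inversion formula for the Laplace transform. -/
lemma integral_cexp_smul_laplace [CompleteSpace V] {f : ℝ → V} (hc : ContinuousOn f (Ici 0))
    (h0 : f 0 = 0) {C a : ℝ} (hf : ∀ t, 0 ≤ t → ‖f t‖ ≤ C * Real.exp (a * t)) {σ : ℝ} (hσ : a < σ)
    (hL : Integrable fun ω : ℝ => laplace f (σ + ω * Complex.I)) {t : ℝ} (ht : 0 < t) :
    ∫ ω : ℝ, Complex.exp ((σ + ω * Complex.I) * t) • laplace f (σ + ω * Complex.I)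
      = (2 * Real.pi) • f t := by
  -- The damped function vanishes for `t ≤ 0` and is continuous there because `f 0 = 0`, so
  -- pointwise Fourier inversion applies to it.
  set h : ℝ → V := fun t => Complex.exp (-(σ * t)) • f (max t 0) with hh
  have hneg : ∀ t, t ∉ Ioi (0 : ℝ) → h t = 0 := by
    intro t ht
    rw [hh]; simp only
    rw [max_eq_right (not_lt.1 ht), h0, smul_zero]
  have hcont : Continuous h := by
    refine Continuous.smul (by fun_prop) (hc.comp_continuous (by fun_prop) fun x => ?_)
    exact le_max_right x 0
  have hint : Integrable h := by
    have h1 := integrableOn_cexp_smul_of_exp_bound hc hf (p := σ) (by simpa using hσ)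
    have h2 : IntegrableOn h (Ioi 0) := by
      refine h1.congr_fun (fun t ht => ?_) measurableSet_Ioi
      rw [hh]; simp only; rw [max_eq_left (le_of_lt ht)]
    exact h2.integrable_of_forall_notMem_eq_zero hneg
  have hfour : ∀ ξ : ℝ, FourierTransform.fourier h ξ
      = laplace f (σ + (2 * Real.pi * ξ : ℝ) * Complex.I) := by
    intro ξ
    rw [Real.fourier_real_eq_integral_exp_smul, laplace,
      ← setIntegral_eq_integral_of_forall_compl_eq_zero (s := Ioi 0)
        (fun x hx => by rw [hneg x hx, smul_zero])]
    refine setIntegral_congr_fun measurableSet_Ioi fun t ht => ?_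
    rw [hh]; simp only
    rw [max_eq_left (le_of_lt ht), smul_smul, ← Complex.exp_add]
    congr 2; push_cast; ring
  have h2π : (2 * Real.pi) ≠ 0 := by positivity
  have hFint : Integrable (FourierTransform.fourier h) := by
    refine (hL.comp_mul_left' h2π).congr (Eventually.of_forall fun ξ => ?_)
    simp only
    rw [hfour]
  have hinv := hint.fourierInv_fourier_eq hFint (v := t) hcont.continuousAt
  rw [Real.fourierInv_eq'] at hinv
  have hsub := Measure.integral_comp_mul_left (fun ω : ℝ =>
    Complex.exp ((σ + ω * Complex.I) * t) • laplace f (σ + ω * Complex.I)) (2 * Real.pi)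
  rw [abs_of_pos (by positivity)] at hsub
  have e : ∫ ξ : ℝ, Complex.exp ((σ + (2 * Real.pi * ξ : ℝ) * Complex.I) * t) •
      laplace f (σ + (2 * Real.pi * ξ : ℝ) * Complex.I) = f t := by
    have : ∀ ξ : ℝ, Complex.exp ((σ + (2 * Real.pi * ξ : ℝ) * Complex.I) * t) •
        laplace f (σ + (2 * Real.pi * ξ : ℝ) * Complex.I) = Complex.exp (σ * t) •
        (Complex.exp ((2 * Real.pi * inner ℝ ξ t : ℝ) * Complex.I) •
          FourierTransform.fourier h ξ) := by
      intro ξ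
      rw [hfour, smul_smul, ← Complex.exp_add]
      congr 2; simp; ring
    simp_rw [this]
    rw [integral_smul, hinv, hh]; simp only
    rw [max_eq_left ht.le, smul_smul, ← Complex.exp_add]
    simp
  rw [e] at hsub
  rw [hsub, smul_smul, mul_inv_cancel₀ h2π, one_smul]

lemma tendsto_cutoff_atTop (β : ℝ) : Tendsto (cutoff β) atTop (𝓝 0) := by
  refine squeeze_zero' ?_ ?_ (tendsto_rpow_neg_atTop (y := 2) (by norm_num))
  · filter_upwards [eventually_ge_atTop 0] with r hr using cutoff_nonneg β hr
  · exact Eventually.of_forall fun r => min_le_right _ _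

variable [CompleteSpace V] {N : V →L[ℂ] V} {α : ℝ}

/-- Solutions of `z = z(0) + t z₁ + I^α (N z)` decay if the spectrum of `N` lies in the sector
`|arg s| > α π / 2`. -/
theorem tendsto_zero_of_volterra (hα₁ : 1 < α) (hα₂ : α < 2)
    (hN : ∀ s ∈ spectrum ℂ N, α * Real.pi / 2 < |s.arg|) {z : ℝ → V} {z₁ : V}
    (hc : ContinuousOn z (Ici 0))
    (h : ∀ t, 0 < t → z t = z 0 + t • z₁ + rlIntegral α (fun s => N (z s)) t) :
    Tendsto z atTop (𝓝 0) := by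
  have hα₀ : 0 < α := by linarith
  obtain ⟨C, a, ha, hz⟩ := exists_exp_bound_of_volterra hα₁ N hc h
  obtain ⟨K, hK0, hK⟩ := exists_norm_laplaceSol_le hα₁ hα₂ hN (z 0) z₁
  set G := laplaceSol N α (z 0) z₁ with hGdef
  have hd : ∀ p : ℂ, 0 ≤ p.re → p ≠ 0 → DifferentiableAt ℂ G p := fun p =>
    differentiableAt_laplaceSol hα₀ hα₂ hN (z 0) z₁
  have hcut := integrable_cutoff_abs (β := α - 2) (by linarith)
  have hKim : ∀ p : ℂ, 0 ≤ p.re → p.im ≠ 0 → ‖G p‖ ≤ K * cutoff (α - 2) |p.im| := by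
    intro p hp hp0
    refine (hK p hp (by rintro rfl; simp at hp0)).trans ?_
    exact mul_le_mul_of_nonneg_left (cutoff_anti (by linarith) (abs_pos.2 hp0)
      (Complex.abs_im_le_norm p)) hK0
  have hne0 : ∀ᵐ ω : ℝ, ω ≠ 0 := by simp [ae_iff]
  have hline0 : ∀ (σ ω : ℝ), 0 < σ → (σ + ω * Complex.I : ℂ) ≠ 0 := by
    intro σ ω hσ h
    have := congrArg Complex.re h
    simp at this; linarith
  have hGmeas : ∀ σ : ℝ, 0 < σ → Continuous fun ω : ℝ => G (σ + ω * Complex.I) := by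
    intro σ hσ
    rw [continuous_iff_continuousAt]
    intro ω
    exact ContinuousAt.comp (g := G)
      (hd _ (by simpa using hσ.le) (hline0 σ ω hσ)).continuousAt (by fun_prop)
  have hGint : ∀ σ : ℝ, 0 < σ → Integrable fun ω : ℝ => G (σ + ω * Complex.I) := by
    intro σ hσ
    refine Integrable.mono' (hcut.const_mul K) (hGmeas σ hσ).aestronglyMeasurable ?_
    filter_upwards [hne0] with ω hω
    simpa using hKim (σ + ω * Complex.I) (by simpa using hσ.le) (by simpa using hω)
  -- Removing `e^{-t} z 0` makes the function vanish at `0` and its transform integrable on vertical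
  -- lines, without affecting the limit at infinity.
  set f : ℝ → V := fun t => z t - Real.exp (-t) • z 0 with hfdef
  have hfc : ContinuousOn f (Ici 0) := hc.sub (by fun_prop)
  have hf0 : f 0 = 0 := by simp [hfdef]
  have hfb : ∀ t, 0 ≤ t → ‖f t‖ ≤ (C + ‖z 0‖) * Real.exp (a * t) := by
    intro t ht
    refine (norm_sub_le _ _).trans ?_
    rw [norm_smul, Real.norm_of_nonneg (Real.exp_pos _).le, add_mul]
    refine add_le_add (hz t ht) ?_
    rw [mul_comm]
    refine mul_le_mul_of_nonneg_left (Real.exp_le_exp.2 ?_) (norm_nonneg _)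
    nlinarith
  have hlap : ∀ p : ℂ, a < p.re → laplace f p = G p := by
    intro p hp
    have hp0 : 0 < p.re := ha.trans hp
    have hzi := integrableOn_cexp_smul_of_exp_bound hc hz hp
    have hL := laplace_volterra hα₀ N h hp0 hzi
    have hres := cpow_mem_resolventSet hα₀ hα₂ hN hp0.le
    have h1 : laplace z p = resolvent N (p ^ (α : ℂ))
        (p ^ (α - 1 : ℂ) • z 0 + p ^ (α - 2 : ℂ) • z₁) := by
      rw [← resolvent_apply_sub hres (laplace z p), hL]; simp
    have hp1 : 0 < (p + 1).re := by simp; linarith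
    have hk := integrableOn_cexp_mul_rlKernel one_pos hp1
    have hk2 := integral_cexp_mul_rlKernel one_pos hp1
    simp only [rlKernel_one, Complex.ofReal_one, mul_one, Complex.cpow_neg_one] at hk hk2
    have e : ∀ t : ℝ, Complex.exp (-(p * t)) • f t
        = Complex.exp (-(p * t)) • z t - Complex.exp (-((p + 1) * t)) • z 0 := by
      intro t
      rw [hfdef]; simp only
      rw [smul_sub, ← Complex.coe_smul (Real.exp (-t)), smul_smul, Complex.ofReal_exp,
        ← Complex.exp_add]
      congr 3; push_cast; ring
    rw [laplace]
    simp_rw [e]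
    rw [integral_sub hzi (hk.smul_const _), integral_smul_const, hk2, hGdef, laplaceSol, ← h1]
    rfl
  -- the inversion formula on the imaginary axis
  have hinv : ∀ t : ℝ, 0 < t →
      ∫ ω : ℝ, Complex.exp ((ω * Complex.I) * t) • G (ω * Complex.I) = (2 * Real.pi) • f t := by
    intro t ht
    have hnorm : ∀ p : ℂ, ‖Complex.exp (p * t)‖ = Real.exp (p.re * t) := by
      intro p; rw [Complex.norm_exp]; simp
    have hEint : ∀ σ : ℝ, 0 < σ → Integrable fun ω : ℝ =>
        Complex.exp ((σ + ω * Complex.I) * t) • G (σ + ω * Complex.I) := by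
      intro σ hσ
      refine (hGint σ hσ).bdd_smul (Real.exp (σ * t)) (by fun_prop) ?_
      refine Eventually.of_forall fun ω => ?_
      rw [hnorm]; simp
    have hright : ∫ ω : ℝ, Complex.exp (((a + 1 : ℝ) + ω * Complex.I) * t) •
        G ((a + 1 : ℝ) + ω * Complex.I) = (2 * Real.pi) • f t := by
      have e : ∀ ω : ℝ, laplace f ((a + 1 : ℝ) + ω * Complex.I) = G ((a + 1 : ℝ) + ω * Complex.I) :=
        fun ω => hlap _ (by simp)
      rw [← integral_cexp_smul_laplace hfc hf0 hfb (lt_add_one a)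
        (by simp_rw [e]; exact hGint _ (by linarith)) ht]
      simp_rw [e]
    have hall : ∀ σ : ℝ, 0 < σ → σ ≤ 1 → ∫ ω : ℝ, Complex.exp ((σ + ω * Complex.I) * t) •
        G (σ + ω * Complex.I) = (2 * Real.pi) • f t := by
      intro σ hσ hσ1
      rw [← hright]
      -- To the right of `Re p = σ` one has `‖p‖ ≥ max |Im p| σ`; the maximum keeps the bound away
      -- from the singularity of the cutoff at `0`.
      refine integral_vertical_eq (F := fun p => Complex.exp (p * t) • G p) (by linarith)
        (B := fun r => Real.exp ((a + 1) * t) * (K * cutoff (α - 2) (max r σ))) ?_ ?_ ?_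
        (hEint σ hσ) (hEint _ (by linarith))
      · intro p h1 h2
        refine DifferentiableAt.smul (by fun_prop) (hd p (by linarith) ?_)
        rintro rfl; simp at h1; linarith
      · have hmax : Tendsto (fun r : ℝ => max r σ) atTop atTop :=
          tendsto_atTop_mono (fun r => le_max_left r σ) tendsto_id
        simpa using (((tendsto_cutoff_atTop (α - 2)).comp hmax).const_mul K).const_mul
          (Real.exp ((a + 1) * t))
      · intro p h1 h2
        rw [norm_smul, hnorm]
        refine mul_le_mul (Real.exp_le_exp.2 (by nlinarith)) ?_ (norm_nonneg _) (Real.exp_pos _).le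
        refine (hK p (by linarith) (by rintro rfl; simp at h1; linarith)).trans ?_
        refine mul_le_mul_of_nonneg_left (cutoff_anti (by linarith) (lt_max_of_lt_right hσ) ?_) hK0
        exact max_le (Complex.abs_im_le_norm p) (h1.trans (Complex.re_le_norm p))
    -- The contour reaches the imaginary axis by dominated convergence: the singularity `|ω|^(α-2)`
    -- is integrable because `α - 2 > -1`.
    have hlim : Tendsto (fun σ : ℝ => ∫ ω : ℝ, Complex.exp ((σ + ω * Complex.I) * t) •
        G (σ + ω * Complex.I)) (𝓝[>] 0)
        (𝓝 (∫ ω : ℝ, Complex.exp ((ω * Complex.I) * t) • G (ω * Complex.I))) := by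
      refine tendsto_integral_filter_of_dominated_convergence
        (fun ω => Real.exp t * (K * cutoff (α - 2) |ω|)) ?_ ?_ ((hcut.const_mul K).const_mul _) ?_
      · filter_upwards [self_mem_nhdsWithin] with σ hσ using (hEint σ hσ).aestronglyMeasurable
      · filter_upwards [self_mem_nhdsWithin, nhdsWithin_le_nhds (Iic_mem_nhds (zero_lt_one' ℝ))]
          with σ hσ hσ1
        filter_upwards [hne0] with ω hω
        rw [norm_smul, hnorm]
        refine mul_le_mul (Real.exp_le_exp.2 ?_) ?_ (norm_nonneg _) (Real.exp_pos _).le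
        · simp only [Complex.add_re, Complex.ofReal_re, Complex.mul_re, Complex.I_re, mul_zero,
            Complex.ofReal_im, Complex.I_im, mul_one, sub_self, add_zero]
          have : σ ≤ 1 := hσ1
          nlinarith
        · simpa using hKim (σ + ω * Complex.I) (by simpa using le_of_lt hσ) (by simpa using hω)
      · filter_upwards [hne0] with ω hω
        have h1 : ContinuousAt (fun p : ℂ => Complex.exp (p * t) • G p) (ω * Complex.I) := by
          refine ContinuousAt.smul (by fun_prop) (hd _ (by simp) ?_).continuousAt
          simpa using hω
        have h2 : Tendsto (fun σ : ℝ => (σ + ω * Complex.I : ℂ)) (𝓝[>] 0) (𝓝 (ω * Complex.I)) := by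
          have : Continuous fun σ : ℝ => (σ + ω * Complex.I : ℂ) := by fun_prop
          simpa using (this.tendsto 0).mono_left nhdsWithin_le_nhds
        exact h1.tendsto.comp h2
    refine tendsto_nhds_unique hlim (tendsto_const_nhds.congr' ?_)
    filter_upwards [self_mem_nhdsWithin, nhdsWithin_le_nhds (Iic_mem_nhds (zero_lt_one' ℝ))]
      with σ hσ hσ1 using (hall σ hσ hσ1).symm
  -- the Riemann-Lebesgue lemma
  have hRL := Real.tendsto_integral_exp_smul_cocompact (fun ω : ℝ => G (ω * Complex.I))
  -- This frequency turns the character `e^{-2πiωw}` of the Riemann-Lebesgue lemma into `e^{iωt}`.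
  have hw : Tendsto (fun t : ℝ => -(2 * Real.pi)⁻¹ * t) atTop (cocompact ℝ) :=
    (tendsto_id.const_mul_atTop_of_neg (by simp [Real.pi_pos])).mono_right atBot_le_cocompact
  have h3 : Tendsto (fun t : ℝ => (2 * Real.pi) • f t) atTop (𝓝 0) := by
    refine (hRL.comp hw).congr' ?_
    filter_upwards [eventually_gt_atTop 0] with t ht
    rw [← hinv t ht]
    refine integral_congr_ae (Eventually.of_forall fun ω => ?_)
    simp only
    rw [Circle.smul_def, Real.fourierChar_apply]
    congr 2
    push_cast
    have : (Real.pi : ℂ) ≠ 0 := by exact_mod_cast Real.pi_ne_zero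
    field_simp
  have h4 : Tendsto f atTop (𝓝 0) := by
    have := h3.const_smul (2 * Real.pi)⁻¹
    simp_rw [smul_smul, inv_mul_cancel₀ (show (2 * Real.pi) ≠ 0 by positivity), one_smul,
      smul_zero] at this
    exact this
  have h5 : Tendsto (fun t : ℝ => Real.exp (-t) • z 0) atTop (𝓝 0) := by
    simpa using Real.tendsto_exp_neg_atTop_nhds_zero.smul_const (z 0)
  simpa [hfdef] using h4.add h5

end

/-! ### Reduction of the singular system to `D^α z = N z` -/

section

section Caputo

variable {V W : Type*} [NormedAddCommGroup V] [NormedSpace ℝ V] [NormedAddCommGroup W]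
  [NormedSpace ℝ W]

lemma caputoDeriv_congr {α : ℝ} {f : ℝ → V} {g : ℝ → V} {t : ℝ} (ht : 0 < t)
    (h : ∀ τ, 0 < τ → deriv (deriv f) τ = g τ) :
    caputoDeriv α f t = (Real.Gamma (2 - α))⁻¹ • ∫ τ in (0 : ℝ)..t, (t - τ) ^ (1 - α) • g τ := by
  rw [caputoDeriv, intervalIntegral.integral_of_le ht.le, intervalIntegral.integral_of_le ht.le]
  congr 1
  exact setIntegral_congr_fun measurableSet_Ioc fun τ hτ => by rw [h τ hτ.1]

lemma caputoDeriv_eq_zero {α : ℝ} {f : ℝ → V} (h : ∀ τ, 0 < τ → f τ = 0) {t : ℝ} (ht : 0 < t) :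
    caputoDeriv α f t = 0 := by
  have h1 : ∀ {g : ℝ → V}, (∀ τ, 0 < τ → g τ = 0) → ∀ τ, 0 < τ → deriv g τ = 0 := by
    intro g hg τ hτ
    have : g =ᶠ[𝓝 τ] fun _ => 0 := by
      filter_upwards [Ioi_mem_nhds hτ] with x hx using hg x hx
    rw [this.deriv_eq, deriv_const]
  rw [caputoDeriv_congr ht (g := fun _ => 0) (h1 (h1 h))]
  simp

lemma IsAdmissible.continuousOn_deriv_deriv {z : ℝ → V} (hz : IsAdmissible z) :
    ContinuousOn (deriv (deriv z)) (Ioi 0) :=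
  hz.contDiffOn_deriv.continuousOn_deriv_of_isOpen isOpen_Ioi le_rfl

/-- The two singularities sit at opposite ends. On `[0, t/2]` the kernel is continuous and `z''`
integrable; on `[t/2, t]` the roles are exchanged. -/
lemma IsAdmissible.intervalIntegrable_caputo {z : ℝ → V} (hz : IsAdmissible z) {α : ℝ}
    (hα₂ : α < 2) {t : ℝ} (ht : 0 < t) :
    IntervalIntegrable (fun τ => (t - τ) ^ (1 - α) • deriv (deriv z) τ) volume 0 t := by
  have ht2 : 0 < t / 2 := by linarith
  have htt : t / 2 ≤ t := by linarith
  refine IntervalIntegrable.trans (b := t / 2) ?_ ?_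
  · refine (hz.integrable _ ht2).continuousOn_smul ?_
    rw [uIcc_of_le ht2.le]
    intro x hx
    refine ((continuousAt_const.sub continuousAt_id).rpow_const (Or.inl ?_)).continuousWithinAt
    exact (by linarith [hx.2] : (0 : ℝ) < t - x).ne'
  · have h1 : IntervalIntegrable (fun τ : ℝ => (t - τ) ^ (1 - α)) volume (t / 2) t := by
      have h2 : IntervalIntegrable (fun u : ℝ => u ^ (1 - α)) volume (t - t / 2) (t - t) :=
        intervalIntegral.intervalIntegrable_rpow' (by linarith)
      simpa using h2.comp_sub_left t
    refine h1.smul_continuousOn (hz.continuousOn_deriv_deriv.mono ?_)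
    rw [uIcc_of_le htt]
    intro x hx
    exact lt_of_lt_of_le ht2 hx.1

lemma IsAdmissible.deriv_clm_comp {z : ℝ → V} (hz : IsAdmissible z) (L : V →L[ℝ] W) {t : ℝ}
    (ht : 0 < t) : deriv (fun s => L (z s)) t = L (deriv z t) :=
  (L.hasFDerivAt.comp_hasDerivAt t (hz.hasDerivAt ht)).deriv

lemma IsAdmissible.deriv_deriv_clm_comp {z : ℝ → V} (hz : IsAdmissible z) (L : V →L[ℝ] W) {t : ℝ}
    (ht : 0 < t) : deriv (deriv fun s => L (z s)) t = L (deriv (deriv z) t) := by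
  have h1 : deriv (fun s => L (z s)) =ᶠ[𝓝 t] fun s => L (deriv z s) := by
    filter_upwards [Ioi_mem_nhds ht] with s hs using hz.deriv_clm_comp L hs
  rw [h1.deriv_eq]
  exact (L.hasFDerivAt.comp_hasDerivAt t (hz.hasDerivAt_deriv ht)).deriv

lemma IsAdmissible.clm_comp {z : ℝ → V} (hz : IsAdmissible z) (L : V →L[ℝ] W) :
    IsAdmissible fun t => L (z t) where
  continuousOn := L.continuous.comp_continuousOn hz.continuousOn
  contDiffOn := L.contDiff.comp_contDiffOn hz.contDiffOn
  integrable T hT := by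
    have h1 := (intervalIntegrable_iff_integrableOn_Ioc_of_le hT.le).1 (hz.integrable T hT)
    rw [intervalIntegrable_iff_integrableOn_Ioc_of_le hT.le]
    exact IntegrableOn.congr_fun (L.integrable_comp h1)
      (fun t ht => (hz.deriv_deriv_clm_comp L ht.1).symm) measurableSet_Ioc

lemma IsAdmissible.caputoDeriv_clm_comp [CompleteSpace V] [CompleteSpace W] {z : ℝ → V}
    (hz : IsAdmissible z)
    (L : V →L[ℝ] W) {α : ℝ} (hα₂ : α < 2) {t : ℝ} (ht : 0 < t) :
    caputoDeriv α (fun s => L (z s)) t = L (caputoDeriv α z t) := by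
  rw [caputoDeriv_congr ht fun τ hτ => hz.deriv_deriv_clm_comp L hτ, caputoDeriv, map_smul,
    ← L.intervalIntegral_comp_comm (hz.intervalIntegrable_caputo hα₂ ht)]
  simp only [map_smul]

end Caputo

/-- Solutions of `z = M D^α z` are killed by the nilpotent part of `M`. -/
lemma IsAdmissible.eq_zero_of_pow_mul_eq_zero {W : Type*} [NormedAddCommGroup W] [NormedSpace ℂ W]
    [CompleteSpace W] {z : ℝ → W} (hz : IsAdmissible z) {α : ℝ} (hα₂ : α < 2) {M Q : W →L[ℂ] W}
    (hM : ∀ t, 0 < t → z t = M (caputoDeriv α z t)) (hMQ : Commute M Q) {k : ℕ}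
    (hk : ∀ t, 0 < t → (M ^ k * Q) (z t) = 0) : ∀ t, 0 < t → Q (z t) = 0 := by
  induction k with
  | zero => simpa using hk
  | succ k ih =>
    -- Since `z = M D^α z`, one has `M^k Q z = M^(k+1) Q D^α z = D^α (M^(k+1) Q z) = 0`.
    refine ih fun t ht => ?_
    have h1 := hz.caputoDeriv_clm_comp ((M ^ (k + 1) * Q).restrictScalars ℝ) hα₂ ht
    have h0 := caputoDeriv_eq_zero (α := α)
      (f := fun s => (M ^ (k + 1) * Q).restrictScalars ℝ (z s)) hk ht
    rw [h0] at h1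
    have h2 : M ^ (k + 1) * Q = M ^ k * Q * M := by rw [pow_succ, mul_assoc, hMQ.eq, mul_assoc]
    rw [hM t ht, ← mul_apply_eq_comp, ← h2]
    exact h1.symm

/-- The Fitting decomposition: `P` is the projector onto the invertible part of `M`, and `N`
inverts `M` there. -/
lemma exists_fitting {W : Type*} [AddCommGroup W] [Module ℂ W] [FiniteDimensional ℂ W]
    (M : Module.End ℂ W) :
    ∃ (P N : Module.End ℂ W) (k : ℕ), Commute M P ∧ M ^ k * (1 - P) = 0 ∧
      N * (M * P - (1 - P)) = 1 ∧
      ∀ s ∈ spectrum ℂ N, s = -1 ∨ ∃ v : W, v ≠ 0 ∧ v = s • M v := by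
  obtain ⟨r, hr, hr0⟩ := Polynomial.exists_eq_pow_rootMultiplicity_mul_and_not_dvd (minpoly ℂ M)
    (minpoly.ne_zero (Algebra.IsIntegral.isIntegral M)) 0
  set k := Polynomial.rootMultiplicity 0 (minpoly ℂ M)
  rw [Polynomial.C_0, sub_zero] at hr hr0
  -- Bézout for `X^(k+1)` and `r` gives the projector `P = a(M) M^(k+1)`. The exponent is `k + 1`
  -- rather than `k` so that `P` has a factor `M` even when `k = 0`; this makes `M` injective on the
  -- range of `P`.
  have hcop : IsCoprime ((Polynomial.X : Polynomial ℂ) ^ (k + 1)) r :=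
    ((Polynomial.prime_X.irreducible.coprime_iff_not_dvd).2 hr0).pow_left
  obtain ⟨a, b, hab⟩ := hcop
  have hzero : Polynomial.aeval M (Polynomial.X ^ k * r) = 0 := by rw [← hr, minpoly.aeval]
  set φ := Polynomial.aeval (R := ℂ) M with hφ
  have hX : φ Polynomial.X = M := Polynomial.aeval_X M
  set P := φ (a * Polynomial.X ^ (k + 1)) with hP
  have hQ : 1 - P = φ (b * r) := by
    rw [sub_eq_iff_eq_add, hP, ← map_add, add_comm, hab, map_one]
  have hcomm : Commute M P := by rw [← hX, hP]; exact (Commute.all _ _).map φ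
  have hMQ : M ^ k * (1 - P) = 0 := by
    rw [hQ, ← hX, ← map_pow, ← map_mul, show (Polynomial.X : Polynomial ℂ) ^ k * (b * r)
      = b * (Polynomial.X ^ k * r) by ring, map_mul, hzero, mul_zero]
  have hPM : P = φ a * M ^ k * M := by rw [hP, map_mul, map_pow, hX, pow_succ, mul_assoc]
  have hPQ : P * (1 - P) = 0 := by
    have h1 : P = φ a * M * M ^ k := by rw [hPM, mul_assoc, mul_assoc, ← pow_succ, ← pow_succ']
    nth_rewrite 1 [h1]
    rw [mul_assoc, hMQ, mul_zero]
  have hPP : P * P = P := by rw [mul_sub, mul_one, sub_eq_zero] at hPQ; exact hPQ.symm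
  have hPP' : ∀ v, P (P v) = P v := fun v => congrArg (fun T : Module.End ℂ W => T v) hPP
  have hc' : ∀ v, M (P v) = P (M v) := fun v => congrArg (fun T : Module.End ℂ W => T v) hcomm.eq
  have hMP0 : ∀ v, M (P v) = 0 → P v = 0 := by
    intro v hv
    have h1 := congrArg (fun T : Module.End ℂ W => T (P v)) hPM
    simp only [Module.End.mul_apply, hPP', hv, map_zero] at h1
    exact h1
  -- `M'` is `M` on the range of `P` and `-1` on its kernel. The value `-1` is chosen because its
  -- argument `π` exceeds `α π / 2`.
  set M' := M * P - (1 - P) with hM'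
  have hM'v : ∀ v, M' v = P (M v) - (v - P v) := fun v => by
    rw [← hc']; simp [hM']
  have hPM' : ∀ v, P (M' v) = M (P v) := fun v => by
    rw [hM'v]; simp [hPP', hc']
  have hunit : IsUnit M' := by
    rw [LinearMap.isUnit_iff_ker_eq_bot, LinearMap.ker_eq_bot']
    intro v hv
    have h1 := hPM' v
    rw [hv, map_zero] at h1
    have h2 := hMP0 v h1.symm
    have h3 := hM'v v
    rw [hv, ← hc', h2] at h3
    simpa using h3.symm
  obtain ⟨u, hu⟩ := hunit
  refine ⟨P, (↑u⁻¹ : Module.End ℂ W), k, hcomm, hMQ, by rw [← hM', ← hu, Units.inv_mul], fun s hs => ?_⟩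
  rw [← Module.End.hasEigenvalue_iff_mem_spectrum] at hs
  obtain ⟨v, hv⟩ := hs.exists_hasEigenvector
  have h1 : v = s • M' v := by
    have : (↑u : Module.End ℂ W) ((↑u⁻¹ : Module.End ℂ W) v) = v := by
      rw [← Module.End.mul_apply, Units.mul_inv, Module.End.one_apply]
    rw [hv.apply_eq_smul, hu, map_smul] at this
    exact this.symm
  have h2 : P v = s • M (P v) := by
    conv_lhs => rw [h1]
    rw [map_smul, hPM']
  by_cases h0 : P v = 0
  · left
    rw [hM'v, ← hc', h0] at h1
    have h3 : (s + 1) • v = 0 := by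
      rw [add_smul, one_smul]
      nth_rewrite 2 [h1]
      simp
    rcases smul_eq_zero.1 h3 with h | h
    · exact eq_neg_of_add_eq_zero_left h
    · exact absurd h hv.2
  · exact Or.inr ⟨P v, h0, h2⟩

/-- Componentwise inclusion of real in complex vectors. -/
def ofRealPi (n : ℕ) : (Fin n → ℝ) →L[ℝ] (Fin n → ℂ) :=
  ContinuousLinearMap.pi fun i => Complex.ofRealCLM.comp (ContinuousLinearMap.proj i)

lemma ofRealPi_apply {n : ℕ} (x : Fin n → ℝ) (i : Fin n) : ofRealPi n x i = (x i : ℂ) := rfl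

lemma ofRealPi_mulVec {n : ℕ} (B : Matrix (Fin n) (Fin n) ℝ) (x : Fin n → ℝ) :
    ofRealPi n (B.mulVec x) = (B.map fun r : ℝ => (r : ℂ)).mulVec (ofRealPi n x) := by
  ext i
  simp [ofRealPi_apply, Matrix.mulVec, dotProduct]

lemma IsSolution.isAdmissible {n : ℕ} {E A : Matrix (Fin n) (Fin n) ℝ} {α : ℝ}
    {x : ℝ → Fin n → ℝ} (h : IsSolution E A α x) : IsAdmissible x :=
  ⟨h.continuousOn, h.contDiffOn, h.integrable⟩

/-- If all finite eigenvalues of the pencil lie in the sector `|arg s| > α π / 2`, then the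
solutions satisfy an ordinary fractional equation `D^α z = N z` whose spectrum lies in that
sector. -/
lemma exists_reduced_equation {n : ℕ} {E A : Matrix (Fin n) (Fin n) ℝ} {α : ℝ}
    (hα₁ : 1 < α) (hα₂ : α < 2)
    (hspec : ∀ s ∈ finiteSpectrum E A, α * Real.pi / 2 < |s.arg|) :
    ∃ N : (Fin n → ℂ) →L[ℂ] (Fin n → ℂ), (∀ s ∈ spectrum ℂ N, α * Real.pi / 2 < |s.arg|) ∧
      ∀ x, IsSolution E A α x → ∀ t, 0 < t →
        caputoDeriv α (fun s => ofRealPi n (x s)) t = N (ofRealPi n (x t)) := by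
  set Ec := E.map (fun r : ℝ => (r : ℂ)) with hEc
  set Ac := A.map (fun r : ℝ => (r : ℂ)) with hAc
  have hdet : IsUnit Ac.det := by
    rw [isUnit_iff_ne_zero]
    intro h0
    have h1 : (0 : ℂ) ∈ finiteSpectrum E A := by
      simp [finiteSpectrum, ← hAc, Matrix.det_neg, h0]
    have h2 := hspec 0 h1
    simp only [Complex.arg_zero, abs_zero] at h2
    have : 0 < α * Real.pi / 2 := by positivity
    linarith
  set M : Module.End ℂ (Fin n → ℂ) := Matrix.toLin' (Ac⁻¹ * Ec) with hM
  obtain ⟨P, N, k, hc, hk, hN, hs⟩ := exists_fitting M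
  set τ := Module.End.toContinuousLinearMap (𝕜 := ℂ) (Fin n → ℂ) with hτ
  refine ⟨τ N, fun s hsN => ?_, fun x hx t ht => ?_⟩
  · rw [AlgEquiv.spectrum_eq] at hsN
    rcases hs s hsN with rfl | ⟨v, hv, hvs⟩
    · rw [Complex.arg_neg_one, abs_of_pos Real.pi_pos]
      nlinarith [Real.pi_pos]
    · refine hspec s (Matrix.exists_mulVec_eq_zero_iff.1 ⟨v, hv, ?_⟩)
      have h1 := congrArg Ac.mulVec hvs
      rw [hM, Matrix.toLin'_apply, Matrix.mulVec_smul, Matrix.mulVec_mulVec, ← mul_assoc,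
        Matrix.mul_nonsing_inv _ hdet, one_mul] at h1
      rw [Matrix.sub_mulVec, Matrix.smul_mulVec, ← hEc, ← hAc, h1, sub_self]
  · have hz := hx.isAdmissible.clm_comp (ofRealPi n)
    set z : ℝ → Fin n → ℂ := fun s => ofRealPi n (x s) with hzdef
    have hzM : ∀ t, 0 < t → z t = τ M (caputoDeriv α z t) := by
      intro t ht
      have h1 := congrArg (ofRealPi n) (hx.equation t ht)
      rw [ofRealPi_mulVec, ofRealPi_mulVec, ← hx.isAdmissible.caputoDeriv_clm_comp _ hα₂ ht,
        ← hEc, ← hAc] at h1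
      change z t = M (caputoDeriv α z t)
      rw [hM, Matrix.toLin'_apply, ← Matrix.mulVec_mulVec, h1, Matrix.mulVec_mulVec,
        Matrix.nonsing_inv_mul _ hdet, Matrix.one_mulVec]
    have hQc : Commute (τ M) (τ (1 - P)) := ((Commute.one_right M).sub_right hc).map τ
    have hQz := hz.eq_zero_of_pow_mul_eq_zero hα₂ hzM hQc (k := k) (fun t _ => by
      rw [← map_pow, ← map_mul, hk, map_zero]; rfl)
    have hQD : τ (1 - P) (caputoDeriv α z t) = 0 := by
      have h1 := hz.caputoDeriv_clm_comp ((τ (1 - P)).restrictScalars ℝ) hα₂ ht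
      have h0 := caputoDeriv_eq_zero (α := α)
        (f := fun s => (τ (1 - P)).restrictScalars ℝ (z s)) hQz ht
      rw [h0] at h1
      exact h1.symm
    set d := caputoDeriv α z t with hd
    have hQd : d - P d = 0 := hQD
    -- The component of `D^α z` in the kernel of `P` vanishes, so `M'` acts on `D^α z` as `M` does
    -- and `N` inverts it.
    have h1 : (M * P - (1 - P)) d = z t := by
      have : (M * P - (1 - P)) d = M (P d) - (d - P d) := rfl
      rw [this, hQd, ← sub_eq_zero.1 hQd, sub_zero]
      exact (hzM t ht).symm
    have h2 := congrArg (fun T : Module.End ℂ (Fin n → ℂ) => T d) hN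
    simp only [Module.End.mul_apply, Module.End.one_apply] at h2
    rw [← h2]
    exact congrArg N h1

/-- Solutions decay if all finite eigenvalues lie in the sector `|arg s| > α π / 2`. -/
theorem IsSolution.tendsto_zero {n : ℕ} {E A : Matrix (Fin n) (Fin n) ℝ} {α : ℝ}
    (hα₁ : 1 < α) (hα₂ : α < 2)
    (hspec : ∀ s ∈ finiteSpectrum E A, α * Real.pi / 2 < |s.arg|) {x : ℝ → Fin n → ℝ}
    (hx : IsSolution E A α x) : Tendsto (fun t => ‖x t‖) atTop (𝓝 0) := by
  obtain ⟨N, hN, h⟩ := exists_reduced_equation hα₁ hα₂ hspec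
  have hz := hx.isAdmissible.clm_comp (ofRealPi n)
  obtain ⟨z₁, hz₁⟩ := hz.exists_volterra hα₁ hα₂ N (h x hx)
  have hlim := tendsto_zero_of_volterra hα₁ hα₂ hN hz.continuousOn hz₁
  refine squeeze_zero (fun t => norm_nonneg _) (fun t => ?_) (tendsto_zero_iff_norm_tendsto_zero.1 hlim)
  refine (pi_norm_le_iff_of_nonneg (norm_nonneg _)).2 fun i => ?_
  have := norm_le_pi_norm (ofRealPi n (x t)) i
  rwa [ofRealPi_apply, Complex.norm_real] at this

end

/-! ### Mittag-Leffler functions -/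

section

lemma rlKernel_pos {b t : ℝ} (hb : 0 < b) (ht : 0 < t) : 0 < rlKernel b t :=
  div_pos (Real.rpow_pos_of_pos ht _) (Real.Gamma_pos_of_pos hb)

/-- Since `α > 1`, eventually `α k + c ≥ k + 1`, so `Γ(α k + c) ≥ k!` and an exponential series
dominates. Taking `k ≥ 1` puts both arguments in `[2, ∞)`, where `Γ` increases. -/
lemma summable_pow_mul_rlKernel {α : ℝ} (hα : 1 < α) (c : ℝ) {r : ℝ} (hr : 0 ≤ r) {t : ℝ}
    (ht : 0 < t) : Summable fun k : ℕ => r ^ k * rlKernel (α * k + c) t := by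
  have hg : Summable fun k : ℕ => t ^ (c - 1) * ((r * t ^ α) ^ k / k.factorial) :=
    (Real.summable_pow_div_factorial _).mul_left _
  refine Summable.of_norm_bounded_eventually_nat hg ?_
  have h1 : Tendsto (fun k : ℕ => (α - 1) * (k : ℝ) + c) atTop atTop :=
    tendsto_atTop_add_const_right _ _
      (tendsto_natCast_atTop_atTop.const_mul_atTop (sub_pos.2 hα))
  filter_upwards [h1.eventually_ge_atTop 1, eventually_ge_atTop 1] with k hk hk1
  have hk1' : (1 : ℝ) ≤ k := by exact_mod_cast hk1
  have h2 : (k : ℝ) + 1 ≤ α * k + c := by linarith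
  have h3 : (k.factorial : ℝ) ≤ Real.Gamma (α * k + c) := by
    rw [← Real.Gamma_nat_eq_factorial]
    refine Real.Gamma_strictMonoOn_Ici.monotoneOn ?_ ?_ h2 <;> rw [mem_Ici] <;> linarith
  have h4 : (0 : ℝ) < k.factorial := by exact_mod_cast k.factorial_pos
  have h5 : t ^ (α * k + c - 1) = t ^ (c - 1) * (t ^ α) ^ k := by
    rw [← Real.rpow_natCast (t ^ α), ← Real.rpow_mul ht.le, ← Real.rpow_add ht]; congr 1; ring
  have h6 : 0 < t ^ (α * k + c - 1) := Real.rpow_pos_of_pos ht _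
  rw [Real.norm_of_nonneg (mul_nonneg (pow_nonneg hr k)
    (rlKernel_nonneg (by linarith) ht.le)), rlKernel]
  calc r ^ k * (t ^ (α * k + c - 1) / Real.Gamma (α * k + c))
      ≤ r ^ k * (t ^ (α * k + c - 1) / k.factorial) := by gcongr
    _ = _ := by rw [h5, mul_pow]; ring

/-- The power series with `t ^ (α - 2) * mlSeries α s (t ^ α)` the second derivative of the
Mittag-Leffler function `E_α (s t ^ α)`. -/
def mlSeries (α : ℝ) (s : ℂ) (u : ℝ) : ℂ :=
  ∑' k : ℕ, s ^ (k + 1) * ((u ^ k / Real.Gamma (α * k + (α - 1)) : ℝ) : ℂ)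

/-- The second derivative of the Mittag-Leffler function `E_α (s t ^ α)`. -/
def mlSecondDeriv (α : ℝ) (s : ℂ) (t : ℝ) : ℂ := ((t ^ (α - 2) : ℝ) : ℂ) * mlSeries α s (t ^ α)

section MittagLeffler

variable {α : ℝ}

lemma mlSeries_bound (hα : 1 < α) (s : ℂ) {R : ℝ} (hR : 0 ≤ R) :
    (Summable fun k : ℕ => ‖s‖ * ((‖s‖ * R) ^ k * rlKernel (α * k + (α - 1)) 1)) ∧
    ∀ (k : ℕ) (u : ℝ), |u| ≤ R → ‖s ^ (k + 1) * ((u ^ k / Real.Gamma (α * k + (α - 1)) : ℝ) : ℂ)‖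
      ≤ ‖s‖ * ((‖s‖ * R) ^ k * rlKernel (α * k + (α - 1)) 1) := by
  refine ⟨(summable_pow_mul_rlKernel hα _ (by positivity) one_pos).mul_left _, fun k u hu => ?_⟩
  have hG : 0 < Real.Gamma (α * k + (α - 1)) := Real.Gamma_pos_of_pos (by
    have : (0 : ℝ) ≤ α * k := by positivity
    linarith)
  rw [norm_mul, norm_pow, Complex.norm_real, norm_div, norm_pow, Real.norm_eq_abs u,
    Real.norm_of_nonneg hG.le, rlKernel, Real.one_rpow, pow_succ, mul_pow]
  calc ‖s‖ ^ k * ‖s‖ * (|u| ^ k / Real.Gamma (α * k + (α - 1)))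
      ≤ ‖s‖ ^ k * ‖s‖ * (R ^ k / Real.Gamma (α * k + (α - 1))) := by gcongr
    _ = _ := by ring

lemma continuous_mlSeries (hα : 1 < α) (s : ℂ) : Continuous (mlSeries α s) := by
  rw [continuous_iff_continuousAt]
  intro u
  obtain ⟨hs, hb⟩ := mlSeries_bound hα s (R := |u| + 1) (by positivity)
  have : ContinuousOn (mlSeries α s) (Metric.ball 0 (|u| + 1)) :=
    continuousOn_tsum (fun k => by fun_prop) hs fun k x hx => hb k x (by
      rw [mem_ball_zero_iff, Real.norm_eq_abs] at hx; exact hx.le)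
  exact this.continuousAt (Metric.isOpen_ball.mem_nhds (by simp))

lemma hasSum_mlSecondDeriv (hα : 1 < α) (s : ℂ) {t : ℝ} (ht : 0 < t) :
    HasSum (fun k : ℕ => s ^ (k + 1) * (rlKernel (α * k + (α - 1)) t : ℂ))
      (mlSecondDeriv α s t) := by
  obtain ⟨hs, hb⟩ := mlSeries_bound hα s (R := |t ^ α|) (by positivity)
  have h1 := (Summable.of_norm_bounded hs fun k => hb k (t ^ α) le_rfl).hasSum.mul_left
    ((t ^ (α - 2) : ℝ) : ℂ)
  refine h1.congr_fun fun k => ?_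
  have h2 : rlKernel (α * k + (α - 1)) t
      = t ^ (α - 2) * ((t ^ α) ^ k / Real.Gamma (α * k + (α - 1))) := by
    rw [← Real.rpow_natCast (t ^ α), ← Real.rpow_mul ht.le, ← mul_div_assoc, ← Real.rpow_add ht,
      rlKernel]
    congr 2; ring
  rw [h2]; push_cast; ring

lemma intervalIntegrable_mlSecondDeriv (hα : 1 < α) (s : ℂ) (a b : ℝ) :
    IntervalIntegrable (mlSecondDeriv α s) volume a b := by
  have h0 : IntervalIntegrable (fun t : ℝ => t ^ (α - 2)) volume a b :=
    intervalIntegral.intervalIntegrable_rpow' (by linarith)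
  have h1 : IntervalIntegrable (fun t : ℝ => ((t ^ (α - 2) : ℝ) : ℂ)) volume a b :=
    ⟨h0.1.ofReal, h0.2.ofReal⟩
  refine h1.mul_continuousOn (Continuous.continuousOn ?_)
  exact (continuous_mlSeries hα s).comp (Real.continuous_rpow_const (by linarith))

lemma continuousOn_mlSecondDeriv (hα : 1 < α) (s : ℂ) : ContinuousOn (mlSecondDeriv α s) (Ioi 0) := by
  intro t ht
  refine ContinuousAt.continuousWithinAt (ContinuousAt.mul ?_ ?_)
  · exact Complex.continuous_ofReal.continuousAt.comp
      (Real.continuousAt_rpow_const t _ (Or.inl (ne_of_gt ht)))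
  · exact ((continuous_mlSeries hα s).comp
      (Real.continuous_rpow_const (by linarith))).continuousAt

/-- Each power is integrated by the Beta identity. The same identity evaluates the integrals of the
norms, whose summability justifies exchanging sum and integral. -/
lemma hasSum_rlIntegral_mlSecondDeriv (hα : 1 < α) (s : ℂ) {b t : ℝ} (hb : 0 < b) (ht : 0 < t) :
    HasSum (fun k : ℕ => s ^ (k + 1) * (rlKernel (b + (α * k + (α - 1))) t : ℂ))
      (rlIntegral b (mlSecondDeriv α s) t) := by
  have hpos : ∀ k : ℕ, 0 < α * k + (α - 1) := fun k => by
    have : (0 : ℝ) ≤ α * k := by positivity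
    linarith
  set F : ℕ → ℝ → ℂ := fun k τ =>
    s ^ (k + 1) * ((rlKernel b (t - τ) * rlKernel (α * k + (α - 1)) τ : ℝ) : ℂ) with hF
  have hval : ∀ k : ℕ, ∫ τ in Ioc 0 t, rlKernel b (t - τ) * rlKernel (α * k + (α - 1)) τ
      = rlKernel (b + (α * k + (α - 1))) t := fun k => by
    rw [← intervalIntegral.integral_of_le ht.le, integral_rlKernel_mul_rlKernel hb (hpos k) ht]
  have hint : ∀ k : ℕ, IntegrableOn
      (fun τ => rlKernel b (t - τ) * rlKernel (α * k + (α - 1)) τ) (Ioc 0 t) := fun k => by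
    refine Integrable.of_integral_ne_zero ?_
    rw [hval]
    exact (rlKernel_pos (add_pos hb (hpos k)) ht).ne'
  have hFint : ∀ k, Integrable (F k) (volume.restrict (Ioc 0 t)) := fun k =>
    ((hint k).ofReal).const_mul _
  have hnorm : ∀ k, ∫ τ in Ioc 0 t, ‖F k τ‖
      = ‖s‖ * (‖s‖ ^ k * rlKernel (α * k + (b + (α - 1))) t) := fun k => by
    have e : ∫ τ in Ioc 0 t, ‖F k τ‖ = ∫ τ in Ioc 0 t,
        ‖s‖ ^ (k + 1) * (rlKernel b (t - τ) * rlKernel (α * k + (α - 1)) τ) := by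
      refine setIntegral_congr_fun measurableSet_Ioc fun τ hτ => ?_
      rw [hF]; simp only
      rw [norm_mul, norm_pow, Complex.norm_real, Real.norm_of_nonneg]
      exact mul_nonneg (rlKernel_nonneg hb (sub_nonneg.2 hτ.2)) (rlKernel_nonneg (hpos k) hτ.1.le)
    rw [e, integral_const_mul, hval, pow_succ,
      show b + (α * k + (α - 1)) = α * k + (b + (α - 1)) by ring]
    ring
  have hsum := hasSum_integral_of_summable_integral_norm hFint (by
    simp_rw [hnorm]
    exact (summable_pow_mul_rlKernel hα _ (norm_nonneg s) ht).mul_left _)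
  have e1 : ∀ k, ∫ τ in Ioc 0 t, F k τ = s ^ (k + 1) * (rlKernel (b + (α * k + (α - 1))) t : ℂ) :=
    fun k => by rw [hF]; simp only; rw [integral_const_mul, integral_complex_ofReal, hval]
  have e2 : ∫ τ in Ioc 0 t, ∑' k, F k τ = rlIntegral b (mlSecondDeriv α s) t := by
    rw [rlIntegral, intervalIntegral.integral_of_le ht.le]
    refine setIntegral_congr_fun measurableSet_Ioc fun τ hτ => ?_
    have h1 := (hasSum_mlSecondDeriv hα s hτ.1).mul_left (rlKernel b (t - τ) : ℂ)
    rw [Complex.real_smul, ← h1.tsum_eq]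
    congr 1; ext k
    rw [hF]; push_cast; ring
  simp_rw [e1, e2] at hsum
  exact hsum

end MittagLeffler

/-- The Mittag-Leffler function `E_α (s t ^ α)`. -/
def mlFun (α : ℝ) (s : ℂ) (t : ℝ) : ℂ :=
  1 + (t * (∫ τ in (0 : ℝ)..t, mlSecondDeriv α s τ) - ∫ τ in (0 : ℝ)..t, τ * mlSecondDeriv α s τ)

section MittagLefflerSolution

variable {α : ℝ}

lemma intervalIntegrable_mul_mlSecondDeriv (hα : 1 < α) (s : ℂ) (a b : ℝ) :
    IntervalIntegrable (fun τ : ℝ => τ * mlSecondDeriv α s τ) volume a b :=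
  (intervalIntegrable_mlSecondDeriv hα s a b).continuousOn_mul (by fun_prop)

/-- The expanded form in `mlFun` suits the fundamental theorem of calculus; the kernel form `I²`
suits the semigroup law. -/
lemma mlFun_eq (hα : 1 < α) (s : ℂ) (t : ℝ) : mlFun α s t = 1 + rlIntegral 2 (mlSecondDeriv α s) t := by
  rw [mlFun, rlIntegral, ← intervalIntegral.integral_const_mul, ← intervalIntegral.integral_sub
    ((intervalIntegrable_mlSecondDeriv hα s 0 t).const_mul _)
    (intervalIntegrable_mul_mlSecondDeriv hα s 0 t)]
  congr 1
  refine intervalIntegral.integral_congr fun τ _ => ?_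
  rw [rlKernel_two, Complex.real_smul]; push_cast; ring

lemma hasDerivAt_integral_of_continuousOn {g : ℝ → ℂ} (hg : ContinuousOn g (Ioi 0))
    (hi : ∀ a b, IntervalIntegrable g volume a b) {t : ℝ} (ht : 0 < t) :
    HasDerivAt (fun t => ∫ τ in (0 : ℝ)..t, g τ) (g t) t :=
  intervalIntegral.integral_hasDerivAt_right (hi 0 t)
    (hg.stronglyMeasurableAtFilter isOpen_Ioi t ht) (hg.continuousAt (Ioi_mem_nhds ht))

lemma hasDerivAt_mlFun (hα : 1 < α) (s : ℂ) {t : ℝ} (ht : 0 < t) :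
    HasDerivAt (mlFun α s) (∫ τ in (0 : ℝ)..t, mlSecondDeriv α s τ) t := by
  have hc := continuousOn_mlSecondDeriv hα s
  have h1 := hasDerivAt_integral_of_continuousOn hc (intervalIntegrable_mlSecondDeriv hα s) ht
  have h2 := hasDerivAt_integral_of_continuousOn (g := fun τ : ℝ => τ * mlSecondDeriv α s τ)
    (ContinuousOn.mul (by fun_prop) hc) (intervalIntegrable_mul_mlSecondDeriv hα s) ht
  have h3 : HasDerivAt (fun t : ℝ => (t : ℂ)) 1 t := Complex.ofRealCLM.hasDerivAt
  exact (((h3.mul h1).sub h2).const_add 1).congr_deriv (by ring)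

lemma deriv_deriv_mlFun (hα : 1 < α) (s : ℂ) {t : ℝ} (ht : 0 < t) :
    deriv (deriv (mlFun α s)) t = mlSecondDeriv α s t := by
  have h1 : deriv (mlFun α s) =ᶠ[𝓝 t] fun t => ∫ τ in (0 : ℝ)..t, mlSecondDeriv α s τ := by
    filter_upwards [Ioi_mem_nhds ht] with x hx using (hasDerivAt_mlFun hα s hx).deriv
  rw [h1.deriv_eq]
  exact (hasDerivAt_integral_of_continuousOn (continuousOn_mlSecondDeriv hα s)
    (intervalIntegrable_mlSecondDeriv hα s) ht).deriv

lemma isAdmissible_mlFun (hα : 1 < α) (s : ℂ) : IsAdmissible (mlFun α s) where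
  continuousOn := by
    have h1 := intervalIntegral.continuous_primitive (intervalIntegrable_mlSecondDeriv hα s) 0
    have h2 := intervalIntegral.continuous_primitive (intervalIntegrable_mul_mlSecondDeriv hα s) 0
    refine Continuous.continuousOn ?_
    unfold mlFun
    fun_prop
  contDiffOn := by
    rw [← one_add_one_eq_two, contDiffOn_succ_iff_deriv_of_isOpen isOpen_Ioi]
    refine ⟨fun t ht => (hasDerivAt_mlFun hα s ht).differentiableAt.differentiableWithinAt,
      by simp, ?_⟩
    rw [← zero_add 1, contDiffOn_succ_iff_deriv_of_isOpen isOpen_Ioi]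
    refine ⟨fun t ht => ?_, by simp, ?_⟩
    · have h1 : deriv (mlFun α s) =ᶠ[𝓝 t] fun t => ∫ τ in (0 : ℝ)..t, mlSecondDeriv α s τ := by
        filter_upwards [Ioi_mem_nhds ht] with x hx using (hasDerivAt_mlFun hα s hx).deriv
      exact ((hasDerivAt_integral_of_continuousOn (continuousOn_mlSecondDeriv hα s)
        (intervalIntegrable_mlSecondDeriv hα s) ht).congr_of_eventuallyEq
          h1).differentiableAt.differentiableWithinAt
    · rw [contDiffOn_zero]
      exact (continuousOn_mlSecondDeriv hα s).congr fun t ht => deriv_deriv_mlFun hα s ht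
  integrable T hT := by
    have h1 := intervalIntegrable_mlSecondDeriv hα s 0 T
    rw [intervalIntegrable_iff_integrableOn_Ioc_of_le hT.le] at h1 ⊢
    exact h1.congr_fun (fun t ht => (deriv_deriv_mlFun hα s ht.1).symm) measurableSet_Ioc

/-- Both sides are the series `∑ s^(k+1) t^(αk) / Γ(αk + 1)`. The constant `1` in `mlFun` supplies
the term `k = 0` of the Mittag-Leffler series, missing from `I²` of its second derivative. -/
lemma rlIntegral_two_sub_mlSecondDeriv (hα : 1 < α) (s : ℂ) (hα₂ : α < 2) {t : ℝ} (ht : 0 < t) :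
    rlIntegral (2 - α) (mlSecondDeriv α s) t = s * mlFun α s t := by
  have h2 := hasSum_rlIntegral_mlSecondDeriv hα s two_pos ht
  have h1 := hasSum_rlIntegral_mlSecondDeriv hα s (sub_pos.2 hα₂) ht
  set g : ℕ → ℂ := fun k => s ^ k * (rlKernel (α * k + 1) t : ℂ) with hg
  have h3 : HasSum (fun k => g (k + 1)) (rlIntegral 2 (mlSecondDeriv α s) t) := by
    refine h2.congr_fun fun k => ?_
    rw [hg]; simp only
    rw [show α * ((k + 1 : ℕ) : ℝ) + 1 = 2 + (α * k + (α - 1)) by push_cast; ring]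
  have h4 : HasSum g (mlFun α s t) := by
    have := (hasSum_nat_add_iff 1).1 h3
    rw [mlFun_eq hα, add_comm]
    simpa [hg, rlKernel_one] using this
  refine h1.unique ?_
  refine (h4.mul_left s).congr_fun fun k => ?_
  rw [hg]; simp only
  rw [show 2 - α + (α * k + (α - 1)) = α * k + 1 by ring, pow_succ]
  ring

lemma caputoDeriv_mlFun (hα : 1 < α) (s : ℂ) (hα₂ : α < 2) {t : ℝ} (ht : 0 < t) :
    caputoDeriv α (mlFun α s) t = s * mlFun α s t := by
  rw [← rlIntegral_two_sub_mlSecondDeriv hα s hα₂ ht, caputoDeriv_eq_rlIntegral, rlIntegral,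
    rlIntegral, intervalIntegral.integral_of_le ht.le, intervalIntegral.integral_of_le ht.le]
  exact setIntegral_congr_fun measurableSet_Ioc fun τ hτ => by
    rw [deriv_deriv_mlFun hα s hτ.1]

lemma mlFun_volterra (hα : 1 < α) (s : ℂ) (hα₂ : α < 2) {t : ℝ} (ht : 0 < t) :
    mlFun α s t = 1 + rlIntegral α (fun τ => s * mlFun α s τ) t := by
  have := rlIntegral_rlIntegral hα.le (sub_pos.2 hα₂) ht (intervalIntegrable_mlSecondDeriv hα s 0 t)
  rw [add_sub_cancel] at this
  rw [mlFun_eq hα, ← this]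
  congr 1
  rw [rlIntegral, rlIntegral, intervalIntegral.integral_of_le ht.le,
    intervalIntegral.integral_of_le ht.le]
  exact setIntegral_congr_fun measurableSet_Ioc fun τ hτ => by
    rw [rlIntegral_two_sub_mlSecondDeriv hα s hα₂ hτ.1]

end MittagLefflerSolution

end

/-! ### Non-decay in the closed sector and instability -/

section

/-- An Abelian theorem: the Abel means of a function tending to `0` tend to `0`. -/
lemma tendsto_mul_integral_exp_mul {g : ℝ → ℝ} (hc : ContinuousOn g (Ici 0)) {C : ℝ}
    (hC : ∀ t, 0 ≤ t → |g t| ≤ C) (hg : Tendsto g atTop (𝓝 0)) :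
    Tendsto (fun ε : ℝ => ε * ∫ t in Ioi (0 : ℝ), Real.exp (-(ε * t)) * g t) (𝓝[>] 0) (𝓝 0) := by
  have hsub : ∀ ε : ℝ, 0 < ε → ε * ∫ t in Ioi (0 : ℝ), Real.exp (-(ε * t)) * g t
      = ∫ u in Ioi (0 : ℝ), Real.exp (-u) * g (ε⁻¹ * u) := by
    intro ε hε
    have := integral_comp_mul_left_Ioi (fun t => Real.exp (-(ε * t)) * g t) 0 (inv_pos.2 hε)
    rw [mul_zero, inv_inv, smul_eq_mul] at this
    rw [← this]
    refine setIntegral_congr_fun measurableSet_Ioi fun u _ => ?_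
    rw [mul_inv_cancel_left₀ hε.ne']
  have hlim : Tendsto (fun ε : ℝ => ∫ u in Ioi (0 : ℝ), Real.exp (-u) * g (ε⁻¹ * u)) (𝓝[>] 0)
      (𝓝 (∫ u in Ioi (0 : ℝ), (0 : ℝ))) := by
    refine tendsto_integral_filter_of_dominated_convergence (fun u => Real.exp (-u) * C) ?_ ?_ ?_ ?_
    · filter_upwards [self_mem_nhdsWithin] with ε hε
      refine ContinuousOn.aestronglyMeasurable ?_ measurableSet_Ioi
      refine ContinuousOn.mul (by fun_prop) (hc.comp (by fun_prop) fun u hu => ?_)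
      exact mul_nonneg (inv_nonneg.2 (le_of_lt hε)) (le_of_lt (mem_Ioi.1 hu))
    · filter_upwards [self_mem_nhdsWithin] with ε hε
      filter_upwards [ae_restrict_mem measurableSet_Ioi] with u hu
      rw [norm_mul, Real.norm_of_nonneg (Real.exp_pos _).le]
      exact mul_le_mul_of_nonneg_left
        (hC _ (mul_nonneg (inv_nonneg.2 (le_of_lt hε)) (le_of_lt hu))) (Real.exp_pos _).le
    · have := (exp_neg_integrableOn_Ioi 0 one_pos).mul_const C
      simpa using this
    · filter_upwards [ae_restrict_mem measurableSet_Ioi] with u hu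
      have h1 : Tendsto (fun ε : ℝ => ε⁻¹ * u) (𝓝[>] 0) atTop :=
        tendsto_inv_nhdsGT_zero.atTop_mul_const hu
      simpa using (hg.comp h1).const_mul (Real.exp (-u))
  rw [integral_zero] at hlim
  refine hlim.congr' ?_
  filter_upwards [self_mem_nhdsWithin] with ε hε using (hsub ε hε).symm

lemma exists_bound_of_tendsto_zero {y : ℝ → ℂ} (hc : ContinuousOn y (Ici 0))
    (hy : Tendsto y atTop (𝓝 0)) : ∃ C : ℝ, ∀ t, 0 ≤ t → ‖y t‖ ≤ C := by
  obtain ⟨T, hT⟩ := eventually_atTop.1 ((tendsto_zero_iff_norm_tendsto_zero.1 hy).eventually_le_const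
    one_pos)
  obtain ⟨C, hC⟩ := isCompact_Icc.bddAbove_image (hc.mono fun x (hx : x ∈ Icc 0 T) => hx.1).norm
  refine ⟨max C 1, fun t ht => ?_⟩
  rcases le_total t T with h | h
  · exact (hC (mem_image_of_mem _ ⟨ht, h⟩)).trans (le_max_left _ _)
  · exact (hT t h).trans (le_max_right _ _)

/-- In the closed sector `|arg s| ≤ α π / 2` the Mittag-Leffler function does not decay. -/
theorem not_tendsto_mlFun {α : ℝ} (hα₁ : 1 < α) (hα₂ : α < 2) {s : ℂ}
    (hs : |s.arg| ≤ α * Real.pi / 2) : ¬ Tendsto (mlFun α s) atTop (𝓝 0) := by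
  intro hlim
  have hα₀ : 0 < α := by linarith
  have hαc : (α : ℂ) ≠ 0 := by exact_mod_cast hα₀.ne'
  have hc := (isAdmissible_mlFun hα₁ s).continuousOn
  obtain ⟨C, hC⟩ := exists_bound_of_tendsto_zero hc hlim
  rcases eq_or_ne s 0 with rfl | hs0
  · have h1 : ∀ t : ℝ, 0 < t → mlFun α 0 t = 1 := by
      intro t ht
      rw [mlFun_volterra hα₁ 0 hα₂ ht]; simp [rlIntegral]
    have h2 : Tendsto (mlFun α 0) atTop (𝓝 1) := by
      refine tendsto_const_nhds.congr' ?_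
      filter_upwards [eventually_gt_atTop 0] with t ht using (h1 t ht).symm
    exact zero_ne_one (tendsto_nhds_unique hlim h2)
  -- `q` is the principal root `s^(1/α)`, whose argument is at most `π / 2` in absolute value. The
  -- pole is approached along `q + ε`, inside the right half-plane even when `q` is imaginary.
  set q : ℂ := Complex.exp (Complex.log s / α) with hq
  have him : (Complex.log s / α).im = s.arg / α := by
    rw [Complex.div_ofReal_im, Complex.log_im]
  have harg : |s.arg / α| ≤ Real.pi / 2 := by
    rw [abs_div, abs_of_pos hα₀, div_le_iff₀ hα₀]; linarith
  have hlog : Complex.log q = Complex.log s / α := by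
    rw [abs_le] at harg
    refine Complex.log_exp ?_ ?_ <;> rw [him] <;> linarith [Real.pi_pos]
  have hq0 : q ≠ 0 := Complex.exp_ne_zero _
  have hqα : q ^ (α : ℂ) = s := by
    rw [Complex.cpow_def_of_ne_zero hq0, hlog, div_mul_cancel₀ _ hαc, Complex.exp_log hs0]
  have hqre : 0 ≤ q.re := by
    rw [← Complex.abs_arg_le_pi_div_two_iff, ← Complex.log_im, hlog, him]; exact harg
  have hqsl := mem_slitPlane_of_re_nonneg hqre hq0
  set Y : ℝ → ℂ := fun ε => laplace (mlFun α s) (q + ε) with hY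
  have hre : ∀ ε : ℝ, 0 < ε → ε ≤ (q + ε : ℂ).re := fun ε _ => by simpa using hqre
  have hYeq : ∀ ε : ℝ, 0 < ε →
      ((q + ε) ^ (α : ℂ) - s) * Y ε = (q + ε) ^ (α - 1 : ℂ) := by
    intro ε hε
    have hpos : 0 < (q + ε : ℂ).re := hε.trans_le (hre ε hε)
    have h1 := laplace_volterra hα₀ (s • ContinuousLinearMap.id ℂ ℂ) (z := mlFun α s) (z₀ := 1)
      (z₁ := 0) (fun t ht => by
        rw [smul_zero, add_zero]
        exact mlFun_volterra hα₁ s hα₂ ht) hpos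
      (integrableOn_cexp_smul_of_exp_bound hc (C := C) (a := 0) (by simpa using hC) hpos)
    simp only [smul_eq_mul, mul_one, mul_zero, add_zero, smul_apply,
      ContinuousLinearMap.id_apply] at h1
    rw [sub_mul, hY]; simp only
    rw [h1]; ring
  -- Because `Re q ≥ 0`, `|e^{-(q+ε)t}| ≤ e^{-εt}`, which bounds `ε Y` by an Abel mean of the norm.
  have hYbd : ∀ ε : ℝ, 0 < ε →
      ‖(ε : ℂ) * Y ε‖ ≤ ε * ∫ t in Ioi (0 : ℝ), Real.exp (-(ε * t)) * ‖mlFun α s t‖ := by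
    intro ε hε
    rw [norm_mul, Complex.norm_real, Real.norm_of_nonneg hε.le]
    refine mul_le_mul_of_nonneg_left ?_ hε.le
    have hi : IntegrableOn (fun t : ℝ => Real.exp (-(ε * t)) * ‖mlFun α s t‖) (Ioi 0) := by
      have := (integrableOn_cexp_smul_of_exp_bound hc (C := C) (a := 0) (by simpa using hC)
        (p := ε) (by simpa using hε)).norm
      refine this.congr (Eventually.of_forall fun t => ?_)
      simp [Complex.norm_exp]
    refine norm_integral_le_of_norm_le hi ?_
    filter_upwards [ae_restrict_mem measurableSet_Ioi] with t ht
    rw [norm_smul, Complex.norm_exp]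
    refine mul_le_mul_of_nonneg_right (Real.exp_le_exp.2 ?_) (norm_nonneg _)
    have h1 := hre ε hε
    have h2 : (-((q + ε) * (t : ℂ))).re = -((q + ε : ℂ).re * t) := by simp
    rw [h2]
    have : (0 : ℝ) < t := ht
    nlinarith
  have hεY : Tendsto (fun ε : ℝ => (ε : ℂ) * Y ε) (𝓝[>] 0) (𝓝 0) := by
    refine squeeze_zero_norm' ?_ (tendsto_mul_integral_exp_mul hc.norm (C := C)
      (by simpa using hC) (tendsto_zero_iff_norm_tendsto_zero.1 hlim))
    filter_upwards [self_mem_nhdsWithin] with ε hε using hYbd ε hε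
  have hcont : Tendsto (fun ε : ℝ => (q + ε : ℂ)) (𝓝[>] 0) (𝓝 q) := by
    have : Continuous fun ε : ℝ => (q + ε : ℂ) := by fun_prop
    simpa using (this.tendsto 0).mono_left nhdsWithin_le_nhds
  -- The quotient `((q + ε)^α - s) / ε` has a finite limit while `ε Y ε` tends to `0`. Their product
  -- is `(q + ε)^(α-1)`, forcing `q^(α-1) = 0` although `q ≠ 0`.
  have hslope : Tendsto (fun ε : ℝ => (ε : ℂ)⁻¹ * ((q + ε) ^ (α : ℂ) - s)) (𝓝[>] 0)
      (𝓝 (α * q ^ (α - 1 : ℂ) * 1)) := by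
    have hd := ((hasDerivAt_id q).cpow_const (c := (α : ℂ)) hqsl).tendsto_slope_zero
    have hof : Tendsto (fun ε : ℝ => (ε : ℂ)) (𝓝[>] 0) (𝓝[≠] 0) := by
      refine tendsto_nhdsWithin_iff.2 ⟨?_, ?_⟩
      · simpa using (Complex.continuous_ofReal.tendsto 0).mono_left nhdsWithin_le_nhds
      · filter_upwards [self_mem_nhdsWithin] with ε hε
        simpa using (ne_of_gt hε : ε ≠ 0)
    have := hd.comp hof
    simpa only [Function.comp_def, id, smul_eq_mul, hqα] using this
  have h1 := hslope.mul hεY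
  rw [mul_zero] at h1
  have h2 : Tendsto (fun ε : ℝ => (q + ε : ℂ) ^ (α - 1 : ℂ)) (𝓝[>] 0) (𝓝 (q ^ (α - 1 : ℂ))) :=
    ((hasDerivAt_id q).cpow_const (c := (α - 1 : ℂ)) hqsl).continuousAt.tendsto.comp hcont
  have h3 : Tendsto (fun ε : ℝ => (q + ε : ℂ) ^ (α - 1 : ℂ)) (𝓝[>] 0) (𝓝 0) := by
    refine h1.congr' ?_
    filter_upwards [self_mem_nhdsWithin] with ε hε
    have hε0 : (ε : ℂ) ≠ 0 := by exact_mod_cast (ne_of_gt hε : ε ≠ 0)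
    rw [← hYeq ε hε]; field_simp
  have h4 := tendsto_nhds_unique h2 h3
  rw [Complex.cpow_eq_zero_iff] at h4
  exact hq0 h4.1

/-- The real-linear map `c ↦ Re (c v)`. -/
def reSmul {n : ℕ} (v : Fin n → ℂ) : ℂ →L[ℝ] (Fin n → ℝ) :=
  ContinuousLinearMap.pi fun i => Complex.reCLM.comp
    ((ContinuousLinearMap.mul ℝ ℂ).flip (v i))

lemma reSmul_apply {n : ℕ} (v : Fin n → ℂ) (c : ℂ) (i : Fin n) :
    reSmul v c i = (c * v i).re := rfl

lemma mulVec_reSmul {n : ℕ} (B : Matrix (Fin n) (Fin n) ℝ) (v : Fin n → ℂ) (c : ℂ) :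
    B.mulVec (reSmul v c) = reSmul ((B.map fun r : ℝ => (r : ℂ)).mulVec v) c := by
  ext i
  simp only [Matrix.mulVec, dotProduct, reSmul_apply, Finset.mul_sum, Complex.re_sum,
    Matrix.map_apply]
  refine Finset.sum_congr rfl fun j _ => ?_
  rw [mul_left_comm, Complex.re_ofReal_mul]

/-- The real parts of the Mittag-Leffler modes along an eigenvector are solutions. -/
lemma isSolution_reSmul_mlFun {n : ℕ} {E A : Matrix (Fin n) (Fin n) ℝ} {α : ℝ}
    (hα₁ : 1 < α) (hα₂ : α < 2) {s : ℂ} {v : Fin n → ℂ}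
    (hv : s • (E.map fun r : ℝ => (r : ℂ)).mulVec v = (A.map fun r : ℝ => (r : ℂ)).mulVec v) :
    IsSolution E A α fun t => reSmul v (mlFun α s t) := by
  have hy := isAdmissible_mlFun hα₁ s
  have h := hy.clm_comp (reSmul v)
  refine ⟨h.continuousOn, h.contDiffOn, h.integrable, fun t ht => ?_⟩
  rw [hy.caputoDeriv_clm_comp _ hα₂ ht, caputoDeriv_mlFun hα₁ s hα₂ ht, mulVec_reSmul,
    mulVec_reSmul, ← hv]
  ext i
  simp only [reSmul_apply, Pi.smul_apply, smul_eq_mul]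
  congr 1; ring

/-- An eigenvalue in the closed sector `|arg s| ≤ α π / 2` prevents asymptotic stability. -/
theorem not_isAsymptoticallyStable {n : ℕ} {E A : Matrix (Fin n) (Fin n) ℝ} {α : ℝ}
    (hα₁ : 1 < α) (hα₂ : α < 2) {s : ℂ} (hs : s ∈ finiteSpectrum E A)
    (harg : |s.arg| ≤ α * Real.pi / 2) : ¬ IsAsymptoticallyStable E A α := by
  intro hstab
  obtain ⟨v, hv0, hv⟩ := Matrix.exists_mulVec_eq_zero_iff.2 hs
  rw [Matrix.sub_mulVec, Matrix.smul_mulVec, sub_eq_zero] at hv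
  have hlim : ∀ w : Fin n → ℂ,
      s • (E.map fun r : ℝ => (r : ℂ)).mulVec w = (A.map fun r : ℝ => (r : ℂ)).mulVec w →
      ∀ i, Tendsto (fun t => (mlFun α s t * w i).re) atTop (𝓝 0) := by
    intro w hw i
    have hsol := isSolution_reSmul_mlFun hα₁ hα₂ hw
    have h1 := tendsto_zero_iff_norm_tendsto_zero.2
      (hstab _ ⟨_, hsol, rfl⟩ _ hsol rfl)
    exact (tendsto_pi_nhds.1 h1) i
  obtain ⟨i, hi⟩ := Function.ne_iff.1 hv0
  have h1 := hlim v hv i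
  -- As `Re (-i c) = Im c`, this second eigenvector controls the imaginary part of the mode.
  have h2 := hlim (-Complex.I • v) (by
    rw [Matrix.mulVec_smul, Matrix.mulVec_smul, ← hv, smul_comm]) i
  have h3 : Tendsto (fun t => mlFun α s t * v i) atTop (𝓝 0) := by
    have h4 := ((Complex.continuous_ofReal.tendsto 0).comp h1).add
      (((Complex.continuous_ofReal.tendsto 0).comp h2).mul_const Complex.I)
    simp only [Complex.ofReal_zero, zero_mul, add_zero] at h4
    refine h4.congr fun t => ?_
    conv_rhs => rw [← Complex.re_add_im (mlFun α s t * v i)]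
    simp [add_comm]
  refine not_tendsto_mlFun hα₁ hα₂ harg ?_
  have h5 := h3.mul_const (v i)⁻¹
  simp only [zero_mul, mul_assoc, mul_inv_cancel₀ hi, mul_one] at h5
  exact h5

end

end SFOS
end

/-- The hypothesis `hreg` is not needed: either side of the equivalence forces the pencil to be
regular. -/
theorem mainTheorem2 (n : ℕ) (E A : Matrix (Fin n) (Fin n) ℝ) (α : ℝ)
    (hα₁ : 1 < α) (hα₂ : α < 2) (hreg : SFOS.IsRegular E A α) :
    SFOS.IsAsymptoticallyStable E A α ↔
      ∀ s ∈ SFOS.finiteSpectrum E A, α * Real.pi / 2 < |Complex.arg s| := by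
  constructor
  · intro h s hs
    by_contra hle
    exact SFOS.not_isAsymptoticallyStable hα₁ hα₂ hs (not_lt.1 hle) h
  · intro h x₀ _ x hx _
    exact hx.tendsto_zero hα₁ hα₂ h
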